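/- A (possibly non-symmetric) norm on a finite-dimensional real vector space $V$ is a function $\Phi\colon V\to[0,\infty)$ that vanishes only at $0$, satisfies $\Phi(cv)=c\,\Phi(v)$ for $c\ge 0$, and satisfies the triangle inequality. It is a Banach–Minkowski norm if it is $C^\infty$ outside $0$ and the second derivative of $\Phi^2$ is positive definite at every nonzero vector. A Finsler metric on a smooth manifold $M$ is a continuous function $\varphi\colon TM\to[0,\infty)$ that is $C^\infty$ outside the zero section and restricts to a Banach–Minkowski norm on each $T_xM$; it is monochromatic if for all $x,y\in M$ there is a linear isomorphism $L\colon T_xM\to T_yM$ with $\varphi\circ L=\varphi|_{T_xM}$. A smooth embedding $f\colon M\to V$ into a vector space with a Banach–Minkowski norm $\Phi$ is isometric if $\Phi(d_xf(v))=\varphi(v)$ for all $x\in M$, $v\in T_xM$. The second fundamental form of $f$ at $p$ is the symmetric bilinear form on $T_pM$ with values in $V/\operatorname{Im}d_pf$ given by the Hessian at $p$ of $\pi\circ f$, where $\pi\colon V\to V/\operatorname{Im}d_pf$ is the quotient projection. If $\dim M=2$ and $\dim V=3$, the quotient is a line, and after identifying it with $\mathbb R$ the form is real-valued and defined up to a nonzero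 factor; it is called definite if it is positive or negative definite, degenerate if it has a nonzero kernel, and indefinite if it is nondegenerate and takes both positive and negative values on pairs $(v,v)$. **Theorem.** Let $(M,\varphi)$ be a two-dimensional monochromatic (possibly Riemannian) Finsler manifold, let $p\in M$, and let $f_i\colon M\to V_i$, $i=1,2$, be smooth isometric embeddings, where $(V_1,\Phi_1)$ and $(V_2,\Phi_2)$ are $3$-dimensional vector spaces with Banach–Minkowski norms. Then the second fundamental forms of $f_1$ and $f_2$ at $p$ are of the same type: either both are definite, or both are indefinite, or both are degenerate. -/

import Mathlib

open scoped Manifold ContDiff Topology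

noncomputable section

/-- A Banach-Minkowski norm on a finite-dimensional real vector space `V`: a possibly
non-symmetric norm that is smooth outside `0` and whose square has positive definite second
derivative at every nonzero vector. The `NormedAddCommGroup` structure on `V` only serves to fix
the topology and the smooth structure, which do not depend on its choice in finite dimension. -/
structure IsBanachMinkowskiNorm {V : Type*} [NormedAddCommGroup V] [NormedSpace ℝ V]
    (Φ : V → ℝ) : Prop where
  nonneg : ∀ v, 0 ≤ Φ v
  eq_zero_iff : ∀ v, Φ v = 0 ↔ v = 0
  pos_homogeneous : ∀ (c : ℝ) (v : V), 0 ≤ c → Φ (c • v) = c * Φ v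
  triangle : ∀ v w, Φ (v + w) ≤ Φ v + Φ w
  smooth : ContDiffOn ℝ ∞ Φ {v | v ≠ 0}
  strictly_convex : ∀ v, v ≠ 0 → ∀ w, w ≠ 0 →
    0 < fderiv ℝ (fderiv ℝ (fun u => Φ u ^ 2)) v w w

/-- A Finsler metric on a smooth `n`-dimensional manifold `M`: a continuous function on the
tangent bundle, smooth outside the zero section, which restricts to a Banach-Minkowski norm on
every tangent space. -/
structure FinslerMetric (n : ℕ) (M : Type*) [TopologicalSpace M]
    [ChartedSpace (EuclideanSpace ℝ (Fin n)) M] [IsManifold (𝓡 n) ∞ M] where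
  toFun : ∀ x : M, TangentSpace (𝓡 n) x → ℝ
  continuous_toFun : Continuous fun v : TangentBundle (𝓡 n) M => toFun v.proj v.snd
  smooth_toFun : ContMDiffOn (𝓡 n).tangent 𝓘(ℝ, ℝ) ∞
    (fun v : TangentBundle (𝓡 n) M => toFun v.proj v.snd) {v | v.snd ≠ 0}
  isBanachMinkowskiNorm : ∀ x : M,
    IsBanachMinkowskiNorm (V := EuclideanSpace ℝ (Fin n)) (toFun x)

/-- A Finsler metric is monochromatic if all tangent spaces are isometric as normed vector
spaces. -/
def FinslerMetric.IsMonochromatic {n : ℕ} {M : Type*} [TopologicalSpace M]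
    [ChartedSpace (EuclideanSpace ℝ (Fin n)) M] [IsManifold (𝓡 n) ∞ M]
    (φ : FinslerMetric n M) : Prop :=
  ∀ x y : M, ∃ L : TangentSpace (𝓡 n) x ≃ₗ[ℝ] TangentSpace (𝓡 n) y,
    ∀ v, φ.toFun y (L v) = φ.toFun x v

/-- `f` is a smooth isometric embedding of the Finsler manifold `(M, φ)` into the vector space `V`
equipped with the Banach-Minkowski norm `Φ`. -/
structure FinslerMetric.IsSmoothIsometricEmbedding {n : ℕ} {M : Type*} [TopologicalSpace M]
    [ChartedSpace (EuclideanSpace ℝ (Fin n)) M] [IsManifold (𝓡 n) ∞ M]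
    {V : Type*} [NormedAddCommGroup V] [NormedSpace ℝ V]
    (φ : FinslerMetric n M) (Φ : V → ℝ) (f : M → V) : Prop where
  isSmoothEmbedding : Manifold.IsSmoothEmbedding (𝓡 n) 𝓘(ℝ, V) ∞ f
  norm_preserving : ∀ (x : M) (v : TangentSpace (𝓡 n) x),
    Φ (mfderiv (𝓡 n) 𝓘(ℝ, V) f x v) = φ.toFun x v

section SecondFundamentalForm

variable {n : ℕ} {M : Type*} [TopologicalSpace M] [ChartedSpace (EuclideanSpace ℝ (Fin n)) M]

/-- The Hessian at `p` of a map `g` from `M` to a normed space, as a bilinear map on `T_p M`.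
It is computed in the preferred chart at `p`, which is the chart through which Mathlib identifies
`T_p M` with the model space. It does not depend on the chart when `p` is a critical point
of `g`, the only case in which it is used. -/
def hessianAt {F : Type*} [NormedAddCommGroup F] [NormedSpace ℝ F] (g : M → F) (p : M) :
    TangentSpace (𝓡 n) p →L[ℝ] TangentSpace (𝓡 n) p →L[ℝ] F :=
  let G : EuclideanSpace ℝ (Fin n) → F := g ∘ (extChartAt (𝓡 n) p).symm
  fderiv ℝ (fderiv ℝ G) (extChartAt (𝓡 n) p p)

variable {V : Type*} [NormedAddCommGroup V] [NormedSpace ℝ V]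

/-- The image of the differential of `f` at `p`, as a linear subspace of `V`. -/
def tangentImage (n : ℕ) {M : Type*} [TopologicalSpace M]
    [ChartedSpace (EuclideanSpace ℝ (Fin n)) M] (f : M → V) (p : M) : Submodule ℝ V :=
  LinearMap.range (mfderiv (𝓡 n) 𝓘(ℝ, V) f p).toLinearMap

instance tangentImage_isClosed [FiniteDimensional ℝ V] (f : M → V) (p : M) :
    IsClosed (tangentImage n f p : Set V) :=
  Submodule.closed_of_finiteDimensional _

/-- The second fundamental form of `f : M → V` at `p`: the Hessian at `p` of `π ∘ f`, where
`π : V → V ⧸ Im d_p f` is the quotient projection. -/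
def secondFundamentalForm (n : ℕ) {M : Type*} [TopologicalSpace M]
    [ChartedSpace (EuclideanSpace ℝ (Fin n)) M] [FiniteDimensional ℝ V] (f : M → V) (p : M) :
    TangentSpace (𝓡 n) p →L[ℝ] TangentSpace (𝓡 n) p →L[ℝ] V ⧸ tangentImage n f p :=
  hessianAt (fun x => (tangentImage n f p).mkQ (f x)) p

end SecondFundamentalForm

section FormTypes

variable {T L : Type*} [AddCommGroup T] [Module ℝ T] [TopologicalSpace T]
  [IsTopologicalAddGroup T] [ContinuousSMul ℝ T]
  [NormedAddCommGroup L] [NormedSpace ℝ L]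

/-- A symmetric bilinear form `B` with values in a one-dimensional space `L` is definite if it is
positive definite for some identification of `L` with `ℝ` (that is, positive or negative definite
for any identification). -/
def IsDefiniteForm (B : T →L[ℝ] T →L[ℝ] L) : Prop :=
  ∃ e : L ≃ₗ[ℝ] ℝ, ∀ v, v ≠ 0 → 0 < e (B v v)

/-- `B` is degenerate if it has a nonzero kernel vector. -/
def IsDegenerateForm (B : T →L[ℝ] T →L[ℝ] L) : Prop :=
  ∃ v, v ≠ 0 ∧ ∀ w, B v w = 0

/-- `B` is nondegenerate and takes values of both signs on the diagonal, for some (equivalently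
any) identification of its one-dimensional target with `ℝ`. -/
def IsIndefiniteForm (B : T →L[ℝ] T →L[ℝ] L) : Prop :=
  ¬ IsDegenerateForm B ∧
    ∃ e : L ≃ₗ[ℝ] ℝ, (∃ v, 0 < e (B v v)) ∧ ∃ w, e (B w w) < 0

end FormTypes

end

/-! Work in a chart with `H = Φ ^ 2`, an immersion `G` into `V` and the squared metrics `g_u(v) = H
(dG_u v)`, all linearly equivalent by monochromaticity. In a frame consisting of the tangent plane
and a transverse vector `n`, the second fundamental form becomes a real form `b`, whose type is the
sign of `formDet b`. It suffices to show that the two determinants have the same sign.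

If `g` is not quadratic, `b` is degenerate (`isQuad_of_nondegenerate`). A non-quadratic squared
gauge in the plane admits no nonzero linear field tangent to its level sets (`isQuad_of_tangent`),
and then no nonzero quadratic field of the kind needed here (`quadratic_eq_zero`). By compactness,
the derivative of `g` in the base point is induced by linear fields (`exists_variation`). If `b` is
nondegenerate, comparing two directions of variation yields a transverse `N` with `dH(Av) N = 0` for
all `v ≠ 0`, where `A = dG_u`. Such an `N` exists at all nearby points. Differentiating this
relation expresses `b(k, v) * d²H(Av)(N, N)` as minus `dH(Av)` of a tangent vector depending only on
`k`. Eliminating the positive factor between two values of `k` gives another tangent linear field,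
whose vanishing forces `b = 0`.

If `g` is quadratic, a Gauss equation holds even though `H` is not Euclidean (`exists_gauss`): a
positive multiple of `formDet b` is determined by `g` and its first two derivatives. Hence the two
determinants agree up to positive factors (`formDet_eq`).

So if either form is nondegenerate, the metric is quadratic and the signs agree; otherwise both
forms are degenerate. -/

noncomputable section

open Filter

/-! ### Squared gauges and Euler's identity -/

/-- A positive function on `E ∖ 0`, positively homogeneous of degree two and smooth outside `0`. -/
structure IsSquaredGauge {E : Type*} [NormedAddCommGroup E] [NormedSpace ℝ E]
    (h : E → ℝ) : Prop where
  pos : ∀ v, v ≠ 0 → 0 < h v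
  smul : ∀ (c : ℝ) (v : E), 0 ≤ c → h (c • v) = c ^ 2 * h v
  contDiffAt : ∀ v, v ≠ 0 → ContDiffAt ℝ ∞ h v

section Gauge

variable {E F : Type*} [NormedAddCommGroup E] [NormedSpace ℝ E]
  [NormedAddCommGroup F] [NormedSpace ℝ F] {h : E → ℝ}

theorem IsBanachMinkowskiNorm.isSquaredGauge {Φ : E → ℝ} (hΦ : IsBanachMinkowskiNorm Φ) :
    IsSquaredGauge fun v => Φ v ^ 2 where
  pos v hv := by
    have : Φ v ≠ 0 := fun h0 => hv ((hΦ.eq_zero_iff v).1 h0)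
    positivity
  smul c v hc := by rw [hΦ.pos_homogeneous c v hc, mul_pow]
  contDiffAt v hv := (hΦ.smooth.contDiffAt (isOpen_ne.mem_nhds hv)).pow 2

namespace IsSquaredGauge

theorem map_zero (hh : IsSquaredGauge h) : h 0 = 0 := by
  simpa using hh.smul 0 0 le_rfl

theorem comp (hh : IsSquaredGauge h) (A : F →L[ℝ] E) (hA : ∀ v, v ≠ 0 → A v ≠ 0) :
    IsSquaredGauge fun v => h (A v) where
  pos v hv := hh.pos _ (hA v hv)
  smul c v hc := by rw [map_smul, hh.smul c _ hc]
  contDiffAt v hv := (hh.contDiffAt _ (hA v hv)).comp v A.contDiff.contDiffAt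

theorem differentiableAt (hh : IsSquaredGauge h) {v : E} (hv : v ≠ 0) :
    DifferentiableAt ℝ h v :=
  (hh.contDiffAt v hv).differentiableAt (by simp)

theorem contDiffAt_fderiv (hh : IsSquaredGauge h) {v : E} (hv : v ≠ 0) :
    ContDiffAt ℝ ∞ (fderiv ℝ h) v :=
  (hh.contDiffAt v hv).fderiv_right (m := ∞) (by simp)

theorem continuousAt_fderiv (hh : IsSquaredGauge h) {v : E} (hv : v ≠ 0) :
    ContinuousAt (fderiv ℝ h) v :=
  (hh.contDiffAt_fderiv hv).continuousAt

theorem differentiableAt_fderiv (hh : IsSquaredGauge h) {v : E} (hv : v ≠ 0) :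
    DifferentiableAt ℝ (fderiv ℝ h) v :=
  (hh.contDiffAt_fderiv hv).differentiableAt (by simp)

theorem continuousAt_fderiv_fderiv (hh : IsSquaredGauge h) {v : E} (hv : v ≠ 0) :
    ContinuousAt (fderiv ℝ (fderiv ℝ h)) v :=
  ((hh.contDiffAt_fderiv hv).fderiv_right (m := ∞) (by simp)).continuousAt

/-- Euler's identity. -/
theorem fderiv_self (hh : IsSquaredGauge h) {v : E} (hv : v ≠ 0) :
    fderiv ℝ h v v = 2 * h v := by
  have h1 : HasDerivAt (fun t : ℝ => t • v) v 1 := by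
    simpa using (hasDerivAt_id (1 : ℝ)).smul_const v
  have hf : HasFDerivAt h (fderiv ℝ h v) ((1 : ℝ) • v) := by
    simpa using (hh.differentiableAt hv).hasFDerivAt
  have h2 : HasDerivAt (fun t : ℝ => h (t • v)) (fderiv ℝ h v v) 1 :=
    hf.comp_hasDerivAt (1 : ℝ) h1
  have h3 : HasDerivAt (fun t : ℝ => t ^ 2 * h v) (2 * h v) 1 := by
    simpa using (hasDerivAt_pow 2 (1 : ℝ)).mul_const (h v)
  refine h2.unique (h3.congr_of_eventuallyEq ?_)
  filter_upwards [lt_mem_nhds (zero_lt_one (α := ℝ))] with t ht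
  exact hh.smul t v ht.le

end IsSquaredGauge

/-- A function continuous outside `0` that vanishes off a hyperplane vanishes outside `0`. -/
theorem eq_zero_of_eq_zero_off_ker {l : E →ₗ[ℝ] ℝ} (hl : l ≠ 0) {f : E → ℝ}
    (hf : ∀ v, v ≠ 0 → ContinuousAt f v) (h0 : ∀ v, l v ≠ 0 → f v = 0) :
    ∀ v, v ≠ 0 → f v = 0 := by
  intro v hv
  by_cases hlv : l v = 0
  · obtain ⟨w, hw⟩ : ∃ w, l w ≠ 0 := by
      by_contra! H
      exact hl (LinearMap.ext H)
    have hc : ContinuousAt (fun t : ℝ => f (v + t • w)) 0 := by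
      have : ContinuousAt (fun t : ℝ => v + t • w) 0 := by fun_prop
      refine ContinuousAt.comp (g := f) ?_ this
      simpa using hf v hv
    have h1 : Tendsto (fun t : ℝ => f (v + t • w)) (𝓝[≠] 0) (𝓝 (f v)) := by
      have := hc.tendsto.mono_left (nhdsWithin_le_nhds (s := {0}ᶜ))
      simpa using this
    refine tendsto_nhds_unique h1 (tendsto_const_nhds.congr' ?_)
    filter_upwards [self_mem_nhdsWithin] with t ht
    symm
    apply h0
    simp only [map_add, map_smul, hlv, zero_add, smul_eq_mul]
    exact mul_ne_zero ht hw
  · exact h0 v hlv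

/-- The only linear vector field tangent to the level sets of `h` is zero. -/
def NoTangentField (h : E → ℝ) : Prop :=
  ∀ Z : E →ₗ[ℝ] E, (∀ v, v ≠ 0 → fderiv ℝ h v (Z v) = 0) → Z = 0

end Gauge

/-! ### Linear algebra and quadratic forms in the plane -/

/-- The Euclidean plane. -/
abbrev Plane : Type := EuclideanSpace ℝ (Fin 2)

namespace Plane

/-- The first vector of the standard basis. -/
def e₀ : Plane := !₂[1, 0]

/-- The second vector of the standard basis. -/
def e₁ : Plane := !₂[0, 1]

@[simp] theorem e₀_zero : e₀ 0 = 1 := rfl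
@[simp] theorem e₀_one : e₀ 1 = 0 := rfl
@[simp] theorem e₁_zero : e₁ 0 = 0 := rfl
@[simp] theorem e₁_one : e₁ 1 = 1 := rfl

theorem ext {v w : Plane} (h0 : v 0 = w 0) (h1 : v 1 = w 1) : v = w := by
  ext i
  fin_cases i
  · exact h0
  · exact h1

theorem eq_comb (v : Plane) : v = v 0 • e₀ + v 1 • e₁ := by
  apply ext <;> simp

theorem ne_zero_iff {v : Plane} : v ≠ 0 ↔ v 0 ≠ 0 ∨ v 1 ≠ 0 := by
  rw [← not_and_or, not_iff_not]
  exact ⟨fun h => by simp [h], fun h => ext h.1 h.2⟩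

theorem e₀_ne_zero : e₀ ≠ 0 := ne_zero_iff.2 (by simp)

theorem e₁_ne_zero : e₁ ≠ 0 := ne_zero_iff.2 (by simp)

theorem linearMap_apply {F : Type*} [AddCommGroup F] [Module ℝ F] (l : Plane →ₗ[ℝ] F)
    (v : Plane) : l v = v 0 • l e₀ + v 1 • l e₁ := by
  conv_lhs => rw [eq_comb v]
  simp

/-- The standard area form. -/
def area (v w : Plane) : ℝ := v 0 * w 1 - v 1 * w 0

/-- The rotation by a right angle. -/
def rot (v : Plane) : Plane := !₂[-v 1, v 0]

@[simp] theorem rot_zero (v : Plane) : rot v 0 = -v 1 := rfl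
@[simp] theorem rot_one (v : Plane) : rot v 1 = v 0 := rfl

theorem sq_pos {v : Plane} (hv : v ≠ 0) : 0 < v 0 ^ 2 + v 1 ^ 2 := by
  rcases ne_zero_iff.1 hv with h | h <;> positivity

/-- The area form with first argument fixed, as a linear form. -/
def areaLeft (v : Plane) : Plane →ₗ[ℝ] ℝ where
  toFun w := area v w
  map_add' a b := by simp [area]; ring
  map_smul' a b := by simp [area]; ring

theorem areaLeft_apply (v w : Plane) : areaLeft v w = area v w := rfl

theorem areaLeft_ne_zero {v : Plane} (hv : v ≠ 0) : areaLeft v ≠ 0 := by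
  intro h
  have := LinearMap.congr_fun h (rot v)
  simp only [areaLeft_apply, area, rot_zero, rot_one, LinearMap.zero_apply] at this
  nlinarith [sq_pos hv]

theorem eq_comb_rot {v : Plane} (hv : v ≠ 0) (w : Plane) :
    w = ((v 0 * w 0 + v 1 * w 1) / (v 0 ^ 2 + v 1 ^ 2)) • v +
      (area v w / (v 0 ^ 2 + v 1 ^ 2)) • rot v := by
  have := (sq_pos hv).ne'
  apply ext <;> simp [area] <;> field_simp <;> ring

theorem eq_smul_of_area_eq_zero {v w : Plane} (hv : v ≠ 0) (h : area v w = 0) :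
    ∃ c : ℝ, w = c • v :=
  ⟨_, by simpa [h] using eq_comb_rot hv w⟩

theorem eq_comb_of_area_ne_zero {v w : Plane} (h : area v w ≠ 0) (z : Plane) :
    z = (area z w / area v w) • v + (area v z / area v w) • w := by
  apply ext <;> simp <;> field_simp <;> simp [area] <;> ring

/-- The quadratic form with coefficients `a`, `b`, `c`. -/
def quad (a b c : ℝ) (v : Plane) : ℝ := a * v 0 ^ 2 + b * (v 0 * v 1) + c * v 1 ^ 2

/-- The symmetric bilinear form associated with `quad a b c`. -/
def polar (a b c : ℝ) (v w : Plane) : ℝ :=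
  a * (v 0 * w 0) + b / 2 * (v 0 * w 1 + v 1 * w 0) + c * (v 1 * w 1)

theorem hasFDerivAt_quad (a b c : ℝ) (v : Plane) :
    HasFDerivAt (quad a b c)
      ((2 * a * v 0 + b * v 1) • (EuclideanSpace.proj 0 : Plane →L[ℝ] ℝ) +
        (b * v 0 + 2 * c * v 1) • (EuclideanSpace.proj 1 : Plane →L[ℝ] ℝ)) v := by
  have h0 : HasFDerivAt (fun v : Plane => v 0)
      (EuclideanSpace.proj 0 : Plane →L[ℝ] ℝ) v :=
    (EuclideanSpace.proj 0 : Plane →L[ℝ] ℝ).hasFDerivAt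
  have h1 : HasFDerivAt (fun v : Plane => v 1)
      (EuclideanSpace.proj 1 : Plane →L[ℝ] ℝ) v :=
    (EuclideanSpace.proj 1 : Plane →L[ℝ] ℝ).hasFDerivAt
  refine ((((h0.pow 2).const_mul a).add ((h0.mul h1).const_mul b)).add
    ((h1.pow 2).const_mul c)).congr_fderiv ?_
  ext w
  simp
  ring

theorem differentiableAt_quad (a b c : ℝ) (v : Plane) : DifferentiableAt ℝ (quad a b c) v :=
  (hasFDerivAt_quad a b c v).differentiableAt

theorem fderiv_quad (a b c : ℝ) (v w : Plane) :
    fderiv ℝ (quad a b c) v w = 2 * polar a b c v w := by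
  rw [(hasFDerivAt_quad a b c v).fderiv]
  simp [polar]
  ring

/-- `q` is a quadratic form on the plane. -/
def IsQuad (q : Plane → ℝ) : Prop := ∃ a b c : ℝ, q = quad a b c

theorem IsQuad.comp {q : Plane → ℝ} (hq : IsQuad q) (L : Plane →ₗ[ℝ] Plane) :
    IsQuad fun v => q (L v) := by
  obtain ⟨a, b, c, rfl⟩ := hq
  refine ⟨quad a b c (L e₀), 2 * polar a b c (L e₀) (L e₁), quad a b c (L e₁), ?_⟩
  ext v
  rw [linearMap_apply L v]
  simp [quad, polar]
  ring

theorem isQuad_iff {q : Plane → ℝ} : IsQuad q ↔ ∀ v, q v =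
    v 0 ^ 2 * q e₀ + v 0 * v 1 * (q (e₀ + e₁) - q e₀ - q e₁) + v 1 ^ 2 * q e₁ := by
  constructor
  · rintro ⟨a, b, c, rfl⟩ v
    simp [quad]
    ring
  · intro h
    refine ⟨q e₀, q (e₀ + e₁) - q e₀ - q e₁, q e₁, ?_⟩
    ext v
    rw [h v, quad]
    ring

end Plane

open Plane

/-! ### Linear vector fields tangent to the level sets -/

section TangentField

variable {h : Plane → ℝ}

/-- If `Z v` were a multiple of `v`, Euler's identity would give `Z v = 0`. Then `Z` has rank one,
with image spanned by `z = Z (rot v)`, and `dh(w) z = 0` off the line of `v`, hence for all `w ≠ 0`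
by continuity. At `w = z` this contradicts `dh(z) z = 2 h(z) > 0`. -/
theorem area_tangent_ne_zero (hh : IsSquaredGauge h) {Z : Plane →ₗ[ℝ] Plane} (hZ : Z ≠ 0)
    (ht : ∀ v, v ≠ 0 → fderiv ℝ h v (Z v) = 0) {v : Plane} (hv : v ≠ 0) : area v (Z v) ≠ 0 := by
  intro ha
  obtain ⟨c, hc⟩ := eq_smul_of_area_eq_zero hv ha
  have hZv : Z v = 0 := by
    have := ht v hv
    rw [hc, map_smul, hh.fderiv_self hv, smul_eq_mul] at this
    have hp := hh.pos v hv
    rcases mul_eq_zero.1 this with h0 | h0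
    · rw [hc, h0, zero_smul]
    · linarith
  have hZ' : ∀ w, Z w = (area v w / (v 0 ^ 2 + v 1 ^ 2)) • Z (rot v) := by
    intro w
    conv_lhs => rw [eq_comb_rot hv w]
    simp [hZv]
  have hz : Z (rot v) ≠ 0 := by
    intro h0
    exact hZ (LinearMap.ext fun w => by simp [hZ' w, h0])
  have := eq_zero_of_eq_zero_off_ker (areaLeft_ne_zero hv)
    (f := fun w => fderiv ℝ h w (Z (rot v)))
    (fun w hw => (hh.continuousAt_fderiv hw).clm_apply continuousAt_const) (by
      intro w hw
      have hw0 : w ≠ 0 := by rintro rfl; simp at hw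
      have h1 := ht w hw0
      rw [hZ' w, map_smul, smul_eq_mul] at h1
      refine (mul_eq_zero.1 h1).resolve_left (div_ne_zero hw (sq_pos hv).ne')) _ hz
  rw [hh.fderiv_self hz] at this
  linarith [hh.pos _ hz]

/-- A squared gauge function whose level sets are tangent to a nonzero linear vector field is a
quadratic form. -/
theorem isQuad_of_tangent (hh : IsSquaredGauge h) {Z : Plane →ₗ[ℝ] Plane} (hZ : Z ≠ 0)
    (ht : ∀ v, v ≠ 0 → fderiv ℝ h v (Z v) = 0) : IsQuad h := by
  set a := Z e₀ 0 with ha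
  set c := Z e₀ 1 with hc
  set b := Z e₁ 0 with hb
  set d := Z e₁ 1 with hd
  have hZ0 : ∀ v, Z v 0 = a * v 0 + b * v 1 := fun v => by
    rw [linearMap_apply Z v]; simp [ha, hb]; ring
  have hZ1 : ∀ v, Z v 1 = c * v 0 + d * v 1 := fun v => by
    rw [linearMap_apply Z v]; simp [hc, hd]; ring
  -- The form `v ∧ Z v`: it has no zeros outside the origin, and its derivative along `Z` is `tr Z`
  -- times itself. The goal is that `h` is a constant multiple of `q`.
  set q := quad c (d - a) (-b) with hq
  have hqa : ∀ v, q v = area v (Z v) := fun v => by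
    simp only [hq, quad, area, hZ0, hZ1]; ring
  have hq0 : ∀ v, v ≠ 0 → q v ≠ 0 := fun v hv => by
    rw [hqa]; exact area_tangent_ne_zero hh hZ ht hv
  have hdq : ∀ v, DifferentiableAt ℝ q v := differentiableAt_quad _ _ _
  have hdZ : ∀ v, fderiv ℝ q v (Z v) = (a + d) * q v := fun v => by
    rw [hq, fderiv_quad]; simp only [polar, quad, hZ0, hZ1]; ring
  have hdv : ∀ v, fderiv ℝ q v v = 2 * q v := fun v => by
    rw [hq, fderiv_quad]; simp only [polar, quad]; ring
  set R : Plane → ℝ := fun v => h v / q v with hR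
  have hRd : ∀ v, v ≠ 0 → DifferentiableAt ℝ R v := fun v hv =>
    by
    simp only [hR, div_eq_mul_inv]
    exact (hh.differentiableAt hv).fun_mul ((hdq v).fun_inv (hq0 v hv))
  have hprod : ∀ v, v ≠ 0 → ∀ w,
      fderiv ℝ h v w = R v * fderiv ℝ q v w + q v * fderiv ℝ R v w := by
    intro v hv w
    have h1 : h =ᶠ[𝓝 v] fun x => R x * q x := by
      filter_upwards [isOpen_ne.mem_nhds hv] with x hx
      rw [hR, div_mul_cancel₀ _ (hq0 x hx)]
    rw [h1.fderiv_eq, fderiv_fun_mul (hRd v hv) (hdq v)]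
    simp
  have hRZ : ∀ v, v ≠ 0 → fderiv ℝ R v (Z v) = -(a + d) * R v := by
    intro v hv
    have h1 := hprod v hv (Z v)
    rw [ht v hv, hdZ] at h1
    apply mul_left_cancel₀ (hq0 v hv)
    linarith
  have hRv : ∀ v, v ≠ 0 → fderiv ℝ R v v = 0 := by
    intro v hv
    have h1 := hprod v hv v
    rw [hh.fderiv_self hv, hdv] at h1
    have h2 : R v * q v = h v := by rw [hR, div_mul_cancel₀ _ (hq0 v hv)]
    have h3 : q v * fderiv ℝ R v v = 0 := by linarith
    exact (mul_eq_zero.1 h3).resolve_left (hq0 v hv)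
  -- The ratio `R` is homogeneous of degree zero, so its maximum on the unit circle is a local
  -- maximum in the plane. The derivative along `Z` vanishes there, but it also equals `-tr Z * R`
  -- with `R ≠ 0`.
  have htr : a + d = 0 := by
    obtain ⟨v, hv, hmax⟩ := (isCompact_sphere (0 : Plane) 1).exists_isMaxOn
      ⟨e₀, by simp [e₀, EuclideanSpace.norm_eq]⟩
      (f := R) (fun v hv => (hRd v (by rintro rfl; simp at hv)).continuousAt.continuousWithinAt)
    have hv0 : v ≠ 0 := by rintro rfl; simp at hv
    have hloc : IsLocalMax R v := by
      filter_upwards [isOpen_ne.mem_nhds hv0] with x hx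
      have hxn : 0 < ‖x‖ := norm_pos_iff.2 hx
      have h1 : R (‖x‖⁻¹ • x) ≤ R v := hmax (by simp [norm_smul, hxn.ne'])
      have h2 : R (‖x‖⁻¹ • x) = R x := by
        have : q (‖x‖⁻¹ • x) = ‖x‖⁻¹ ^ 2 * q x := by
          simp only [hq, quad, PiLp.smul_apply, smul_eq_mul]; ring
        simp only [hR]
        rw [hh.smul _ _ (by positivity), this]
        exact mul_div_mul_left _ _ (by positivity)
      rwa [h2] at h1
    have h1 := hRZ v hv0
    rw [hloc.fderiv_eq_zero] at h1
    have h2 : R v ≠ 0 := div_ne_zero (hh.pos v hv0).ne' (hq0 v hv0)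
    rw [zero_apply] at h1
    exact (mul_eq_zero.1 (by linarith : (a + d) * R v = 0)).resolve_right h2
  -- `v` and `Z v` span the plane, and `dR` kills both.
  have hR0 : ∀ v, v ≠ 0 → fderiv ℝ R v = 0 := by
    intro v hv
    ext w
    have h1 : area v (Z v) ≠ 0 := by rw [← hqa]; exact hq0 v hv
    rw [eq_comb_of_area_ne_zero h1 w]
    simp [hRv v hv, hRZ v hv, htr]
  have hconn : IsPreconnected ({0}ᶜ : Set Plane) :=
    (isConnected_compl_singleton_of_one_lt_rank (by
      rw [← Module.finrank_eq_rank]; simp) 0).isPreconnected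
  obtain ⟨k, hk⟩ := isOpen_compl_singleton.exists_is_const_of_fderiv_eq_zero hconn
    (f := R) (fun v hv => (hRd v hv).differentiableWithinAt) (fun v hv => hR0 v hv)
  refine ⟨k * c, k * (d - a), k * (-b), ?_⟩
  ext v
  have hkq : quad (k * c) (k * (d - a)) (k * (-b)) v = k * q v := by
    simp only [hq, quad]; ring
  rw [hkq]
  by_cases hv : v = 0
  · subst hv
    simp [hh.map_zero, hq, quad]
  · rw [← hk v hv, hR, div_mul_cancel₀ _ (hq0 v hv)]

theorem noTangentField_of_not_isQuad (hh : IsSquaredGauge h) (hq : ¬ IsQuad h) :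
    NoTangentField h := by
  intro Z hZ
  by_contra h0
  exact hq (isQuad_of_tangent hh h0 hZ)

end TangentField

/-! ### Quadratic vector fields and planar shadow boundaries -/

section QuadraticField

variable {h : Plane → ℝ}

/-- For even `W` the function `v ↦ area v (W v)` is odd, so it takes opposite values at the ends of
a half circle and the intermediate value theorem applies. -/
theorem exists_ne_zero_area_eq_zero {W : Plane → Plane} (hc : Continuous W)
    (he : ∀ v, W (-v) = W v) : ∃ v, v ≠ 0 ∧ area v (W v) = 0 := by
  set γ : ℝ → Plane := fun t => Real.cos t • e₀ + Real.sin t • e₁ with hγ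
  have hγc : Continuous γ := by fun_prop
  have hπ : γ Real.pi = -γ 0 := by simp [hγ]
  set f : ℝ → ℝ := fun t => area (γ t) (W (γ t)) with hf
  have hfc : Continuous f := by
    have h0 : ∀ i : Fin 2, Continuous fun v : Plane => v i := fun i => by fun_prop
    have hW : Continuous fun t => W (γ t) := hc.comp hγc
    exact (((h0 0).comp hγc).mul ((h0 1).comp hW)).sub (((h0 1).comp hγc).mul ((h0 0).comp hW))
  have hfπ : f Real.pi = -f 0 := by
    simp only [hf, hπ, he, area, PiLp.neg_apply]
    ring
  obtain ⟨t, ht⟩ : (0 : ℝ) ∈ Set.range f := by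
    rcases le_total (f 0) 0 with h | h
    · exact mem_range_of_exists_le_of_exists_ge hfc ⟨0, h⟩ ⟨Real.pi, by linarith⟩
    · exact mem_range_of_exists_le_of_exists_ge hfc ⟨Real.pi, by linarith⟩ ⟨0, h⟩
  refine ⟨γ t, ?_, ht⟩
  have h1 := Real.sin_sq_add_cos_sq t
  refine ne_zero_iff.2 ?_
  by_contra! h0
  simp [hγ] at h0
  simp [h0.1, h0.2] at h1

/-- A quadratic vector field tangent to the level sets of `h` vanishes if `h` admits no nonzero
tangent linear vector field. -/
theorem NoTangentField.quadratic_eq_zero (hN : NoTangentField h) (hh : IsSquaredGauge h)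
    {X Y : Plane →ₗ[ℝ] Plane} {l m : Plane →ₗ[ℝ] ℝ}
    (ht : ∀ v, v ≠ 0 → fderiv ℝ h v (l v • X v - m v • Y v) = 0) (v : Plane) :
    l v • X v = m v • Y v := by
  set W : Plane → Plane := fun v => l v • X v - m v • Y v with hW
  have hWc : Continuous W := by
    have h1 := X.continuous_of_finiteDimensional
    have h2 := Y.continuous_of_finiteDimensional
    have h3 := l.continuous_of_finiteDimensional
    have h4 := m.continuous_of_finiteDimensional
    exact (h3.smul h1).sub (h4.smul h2)
  obtain ⟨v₀, hv₀, ha⟩ := exists_ne_zero_area_eq_zero hWc (fun v => by simp [hW])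
  have hW0 : W v₀ = 0 := by
    obtain ⟨c, hc⟩ := eq_smul_of_area_eq_zero hv₀ ha
    have h1 : fderiv ℝ h v₀ (W v₀) = 0 := ht v₀ hv₀
    rw [hc, map_smul, hh.fderiv_self hv₀, smul_eq_mul] at h1
    have hp := hh.pos v₀ hv₀
    rcases mul_eq_zero.1 h1 with h0 | h0
    · rw [hc, h0, zero_smul]
    · linarith
  set v₁ := rot v₀ with hv₁
  have hN0 : area v₀ v₁ ≠ 0 := by
    simp only [area, hv₁, rot_zero, rot_one]
    nlinarith [sq_pos hv₀]
  set P : Plane := l v₀ • X v₁ + l v₁ • X v₀ - (m v₀ • Y v₁ + m v₁ • Y v₀) with hP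
  set N := area v₀ v₁
  -- A quadratic field vanishing at `v₀` is divisible by the linear form `area v₀`. The quotient `Z`
  -- is read off from the expansion of `W` in the basis `v₀, v₁`, with `P` as mixed coefficient.
  set Z : Plane →ₗ[ℝ] Plane :=
    N⁻¹ • ((-areaLeft v₁).smulRight P + (areaLeft v₀).smulRight (W v₁)) with hZ
  have hWZ : ∀ v, W v = (area v₀ v / N) • Z v := by
    intro v
    have h1 : Z v = N⁻¹ • (area v v₁ • P + area v₀ v • W v₁) := by
      simp [hZ, areaLeft_apply, area]
      congr 2
      ring
    have h2 : W v = (area v v₁ / N) ^ 2 • W v₀ + (area v₀ v / N * (area v v₁ / N)) • P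
        + (area v₀ v / N) ^ 2 • W v₁ := by
      simp only [hW]
      conv_lhs => rw [eq_comb_of_area_ne_zero hN0 v]
      simp only [map_add, map_smul, hP]
      module
    rw [h2, hW0, h1]
    module
  have hZ0 : Z = 0 := by
    apply hN
    refine eq_zero_of_eq_zero_off_ker (areaLeft_ne_zero hv₀) (fun v hv =>
      (hh.continuousAt_fderiv hv).clm_apply Z.continuous_of_finiteDimensional.continuousAt) ?_
    intro v hv
    have hv0 : v ≠ 0 := by rintro rfl; simp at hv
    have h1 : fderiv ℝ h v (W v) = 0 := ht v hv0
    rw [hWZ, map_smul, smul_eq_mul] at h1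
    exact (mul_eq_zero.1 h1).resolve_left (div_ne_zero hv hN0)
  have h1 := hWZ v
  rw [hZ0, LinearMap.zero_apply, smul_zero] at h1
  exact sub_eq_zero.1 h1

/-- The determinant of a bilinear form on the plane in the standard basis. -/
def formDet (b : Plane →L[ℝ] Plane →L[ℝ] ℝ) : ℝ :=
  b e₀ e₀ * b e₁ e₁ - b e₀ e₁ * b e₁ e₀

theorem exists_dual {b : Plane →L[ℝ] Plane →L[ℝ] ℝ} (hb : formDet b ≠ 0) :
    ∃ k₀ k₁ : Plane, b e₀ k₀ = 1 ∧ b e₀ k₁ = 0 ∧ b e₁ k₀ = 0 ∧ b e₁ k₁ = 1 := by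
  refine ⟨(formDet b)⁻¹ • (b e₁ e₁ • e₀ - b e₁ e₀ • e₁),
    (formDet b)⁻¹ • (b e₀ e₀ • e₁ - b e₀ e₁ • e₀), ?_, ?_, ?_, ?_⟩ <;>
  simp only [map_smul, map_sub, smul_eq_mul] <;> field_simp <;> simp only [formDet] <;> ring

theorem exists_ne_zero_of_formDet {b : Plane →L[ℝ] Plane →L[ℝ] ℝ} (hb : formDet b ≠ 0)
    {v : Plane} (hv : v ≠ 0) : b e₀ v ≠ 0 ∨ b e₁ v ≠ 0 := by
  by_contra! h0
  have h1 : ∀ l : Plane →L[ℝ] ℝ, l v = v 0 * l e₀ + v 1 * l e₁ := fun l =>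
    linearMap_apply l.toLinearMap v
  rw [h1, h1 (b e₁)] at h0
  apply hv
  apply Plane.ext
  · apply mul_left_cancel₀ hb
    rw [formDet]
    simp only [PiLp.zero_apply]
    linear_combination b e₁ e₁ * h0.1 - b e₀ e₁ * h0.2
  · apply mul_left_cancel₀ hb
    rw [formDet]
    simp only [PiLp.zero_apply]
    linear_combination b e₀ e₀ * h0.2 - b e₁ e₀ * h0.1

variable {V : Type*} [NormedAddCommGroup V] [NormedSpace ℝ V]

theorem fderiv_comp_linear {H : V → ℝ} (hH : IsSquaredGauge H) {A : Plane →L[ℝ] V}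
    (hA : ∀ v, v ≠ 0 → A v ≠ 0) {v : Plane} (hv : v ≠ 0) (w : Plane) :
    fderiv ℝ (fun v => H (A v)) v w = fderiv ℝ H (A v) (A w) := by
  have := (hH.differentiableAt (hA v hv)).hasFDerivAt.comp v A.hasFDerivAt
  rw [show (fun v => H (A v)) = H ∘ A from rfl, this.fderiv]
  rfl

/-- The shadow boundary in a suitable transverse direction is planar. -/
theorem NoTangentField.exists_normal {H : V → ℝ} (hH : IsSquaredGauge H) {A : Plane →L[ℝ] V}
    (hA : ∀ v, v ≠ 0 → A v ≠ 0) (hN : NoTangentField fun v => H (A v)) {n : V}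
    {b : Plane →L[ℝ] Plane →L[ℝ] ℝ} (hb : formDet b ≠ 0) {X Y : Plane →ₗ[ℝ] Plane}
    (hX : ∀ v, v ≠ 0 → fderiv ℝ H (A v) (A (X v)) = b e₀ v * fderiv ℝ H (A v) n)
    (hY : ∀ v, v ≠ 0 → fderiv ℝ H (A v) (A (Y v)) = b e₁ v * fderiv ℝ H (A v) n) :
    ∃ x₀, ∀ v, v ≠ 0 → fderiv ℝ H (A v) (n - A x₀) = 0 := by
  have hg : IsSquaredGauge fun v => H (A v) := hH.comp A hA
  -- Multiplying the two hypotheses crosswise by `b e₁ v` and `b e₀ v` and subtracting cancels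
  -- `dH(Av) n`, which leaves a tangent quadratic field.
  have hq := hN.quadratic_eq_zero hg (X := X) (Y := Y) (l := (b e₁).toLinearMap)
    (m := (b e₀).toLinearMap) (by
      intro v hv
      rw [fderiv_comp_linear hH hA hv]
      simp only [map_sub, map_smul, smul_eq_mul, hX v hv, hY v hv, ContinuousLinearMap.coe_coe]
      ring)
  simp only [ContinuousLinearMap.coe_coe] at hq
  -- In the basis dual to the forms `b e₀`, `b e₁`, the identity `hq` shows that `X` and `Y` are
  -- these two forms times one common vector.
  obtain ⟨k₀, k₁, h00, h01, h10, h11⟩ := exists_dual hb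
  have hXk : X k₁ = 0 := by simpa [h01, h11] using hq k₁
  have hYk : Y k₀ = 0 := by simpa [h00, h10] using (hq k₀).symm
  have hXY : X k₀ = Y k₁ := by simpa [h00, h01, h10, h11, hXk, hYk] using hq (k₀ + k₁)
  have hcomb : ∀ v, v = b e₀ v • k₀ + b e₁ v • k₁ := by
    intro v
    by_contra hne
    have h0 : v - (b e₀ v • k₀ + b e₁ v • k₁) ≠ 0 := sub_ne_zero.2 hne
    rcases exists_ne_zero_of_formDet hb h0 with h1 | h1 <;>
      simp [h00, h01, h10, h11] at h1
  have hXv : ∀ v, X v = b e₀ v • X k₀ := fun v => by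
    conv_lhs => rw [hcomb v]
    simp [hXk]
  have hYv : ∀ v, Y v = b e₁ v • X k₀ := fun v => by
    conv_lhs => rw [hcomb v]
    simp [hYk, hXY]
  refine ⟨X k₀, fun v hv => ?_⟩
  rw [map_sub, sub_eq_zero]
  rcases exists_ne_zero_of_formDet hb hv with h1 | h1
  · apply mul_left_cancel₀ h1
    rw [← hX v hv, hXv v, map_smul, map_smul, smul_eq_mul]
  · apply mul_left_cancel₀ h1
    rw [← hY v hv, hYv v, map_smul, map_smul, smul_eq_mul]

end QuadraticField

/-! ### Variations of linearly equivalent gauges, by compactness -/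

section Compactness

theorem IsSquaredGauge.exists_bounds {h : Plane → ℝ} (hh : IsSquaredGauge h) :
    ∃ m M : ℝ, 0 < m ∧ ∀ v, m * ‖v‖ ^ 2 ≤ h v ∧ h v ≤ M * ‖v‖ ^ 2 := by
  have hne : (Metric.sphere (0 : Plane) 1).Nonempty := ⟨e₀, by simp [e₀, EuclideanSpace.norm_eq]⟩
  have hc : ContinuousOn h (Metric.sphere (0 : Plane) 1) := fun v hv =>
    (hh.differentiableAt (by rintro rfl; simp at hv)).continuousAt.continuousWithinAt
  obtain ⟨a, ha, hmin⟩ := (isCompact_sphere (0 : Plane) 1).exists_isMinOn hne hc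
  obtain ⟨b, hb, hmax⟩ := (isCompact_sphere (0 : Plane) 1).exists_isMaxOn hne hc
  refine ⟨h a, h b, hh.pos a (by rintro rfl; simp at ha), fun v => ?_⟩
  by_cases hv : v = 0
  · simp [hv, hh.map_zero]
  have hn : 0 < ‖v‖ := norm_pos_iff.2 hv
  have hs : ‖v‖⁻¹ • v ∈ Metric.sphere (0 : Plane) 1 := by simp [norm_smul, hn.ne']
  have h1 : h v = ‖v‖ ^ 2 * h (‖v‖⁻¹ • v) := by
    rw [← hh.smul _ _ hn.le, smul_smul, mul_inv_cancel₀ hn.ne', one_smul]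
  have h2 : h a ≤ h (‖v‖⁻¹ • v) := hmin hs
  have h3 : h (‖v‖⁻¹ • v) ≤ h b := hmax hs
  rw [h1]
  constructor <;> nlinarith [sq_nonneg ‖v‖]

theorem IsSquaredGauge.continuous {h : Plane → ℝ} (hh : IsSquaredGauge h) : Continuous h := by
  rw [continuous_iff_continuousAt]
  intro v
  by_cases hv : v = 0
  · subst hv
    obtain ⟨m, M, hm, hb⟩ := hh.exists_bounds
    rw [ContinuousAt, hh.map_zero]
    have h1 : Tendsto (fun v : Plane => m * ‖v‖ ^ 2) (𝓝 0) (𝓝 0) := by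
      have : Continuous fun v : Plane => m * ‖v‖ ^ 2 := by fun_prop
      simpa using this.tendsto 0
    have h2 : Tendsto (fun v : Plane => M * ‖v‖ ^ 2) (𝓝 0) (𝓝 0) := by
      have : Continuous fun v : Plane => M * ‖v‖ ^ 2 := by fun_prop
      simpa using this.tendsto 0
    exact tendsto_of_tendsto_of_tendsto_of_le_of_le h1 h2 (fun v => (hb v).1) (fun v => (hb v).2)
  · exact (hh.differentiableAt hv).continuousAt

theorem norm_le_of_basis (L : Plane →L[ℝ] Plane) : ‖L‖ ≤ ‖L e₀‖ + ‖L e₁‖ := by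
  refine L.opNorm_le_bound (by positivity) fun v => ?_
  have h1 : L v = v 0 • L e₀ + v 1 • L e₁ := linearMap_apply L.toLinearMap v
  have h2 : ‖v 0‖ ≤ ‖v‖ := PiLp.norm_apply_le v 0
  have h3 : ‖v 1‖ ≤ ‖v‖ := PiLp.norm_apply_le v 1
  rw [h1]
  refine (norm_add_le _ _).trans ?_
  rw [norm_smul, norm_smul, add_mul, mul_comm ‖L e₀‖, mul_comm ‖L e₁‖]
  gcongr

variable {X : Type*} [NormedAddCommGroup X] {g : X → Plane → ℝ} {u : X}

/-- Along a sequence of parameters converging to `u`, the linear equivalences between the functions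
`g` can be chosen to converge to the identity. -/
theorem exists_equivalences_tendsto_id (hg : IsSquaredGauge (g u))
    (hL : ∀ᶠ u' in 𝓝 u, ∃ L : Plane →ₗ[ℝ] Plane, ∀ v, g u' v = g u (L v))
    (hc : ∀ v, v ≠ 0 → ContinuousAt (fun u' => g u' v) u) {x : ℕ → X}
    (hx : Tendsto x atTop (𝓝 u)) :
    ∃ (σ : ℕ → ℕ) (D : ℕ → Plane →L[ℝ] Plane), StrictMono σ ∧ Tendsto D atTop (𝓝 0) ∧
      ∀ᶠ j in atTop, ∀ v, g (x (σ j)) v = g u (v + D j v) := by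
  -- Equivalences exist only for large `j`; elsewhere the choice `0` is a harmless filler.
  have h1 : ∀ j, ∃ L : Plane →L[ℝ] Plane, (∃ L' : Plane →ₗ[ℝ] Plane,
      ∀ v, g (x j) v = g u (L' v)) → ∀ v, g (x j) v = g u (L v) := by
    intro j
    by_cases h : ∃ L' : Plane →ₗ[ℝ] Plane, ∀ v, g (x j) v = g u (L' v)
    · obtain ⟨L', hL'⟩ := h
      exact ⟨L'.toContinuousLinearMap, fun _ => hL'⟩
    · exact ⟨0, fun h' => absurd h' h⟩
  choose L hL' using h1
  have hLj : ∀ᶠ j in atTop, ∀ v, g (x j) v = g u (L j v) :=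
    (hx.eventually hL).mono fun j hj => hL' j hj
  obtain ⟨m, M, hm, hb⟩ := hg.exists_bounds
  -- The lower bound `m * ‖L j v‖ ^ 2 ≤ g u (L j v) = g (x j) v` bounds the equivalences, so a
  -- subsequence converges.
  have hbd : ∀ v, v ≠ 0 → ∀ᶠ j in atTop, ‖L j v‖ ≤ Real.sqrt ((g u v + 1) / m) := by
    intro v hv
    have h2 : ∀ᶠ j in atTop, g (x j) v < g u v + 1 :=
      ((hc v hv).tendsto.comp hx).eventually (gt_mem_nhds (by simp))
    filter_upwards [h2, hLj] with j h2 h3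
    apply Real.le_sqrt_of_sq_le
    rw [le_div_iff₀ hm]
    have h4 := (hb (L j v)).1
    rw [← h3 v] at h4
    linarith
  obtain ⟨L', -, σ, hσ, hlim⟩ := tendsto_subseq_of_frequently_bounded
    (Metric.isBounded_closedBall (x := (0 : Plane →L[ℝ] Plane)) (r :=
      Real.sqrt ((g u e₀ + 1) / m) + Real.sqrt ((g u e₁ + 1) / m))) (x := L) (by
    apply Eventually.frequently
    filter_upwards [hbd e₀ e₀_ne_zero, hbd e₁ e₁_ne_zero] with j h2 h3
    rw [mem_closedBall_zero_iff]
    exact (norm_le_of_basis _).trans (add_le_add h2 h3))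
  have hinv : ∀ v, g u (L' v) = g u v := by
    intro v
    by_cases hv : v = 0
    · simp [hv]
    have h2 : Tendsto (fun j => g u (L (σ j) v)) atTop (𝓝 (g u (L' v))) := by
      refine (hg.continuous.tendsto _).comp ?_
      exact ((ContinuousLinearMap.apply ℝ Plane v).continuous.tendsto L').comp hlim
    have h3 : Tendsto (fun j => g (x (σ j)) v) atTop (𝓝 (g u v)) :=
      (hc v hv).tendsto.comp (hx.comp hσ.tendsto_atTop)
    refine tendsto_nhds_unique h2 (h3.congr' ?_)
    filter_upwards [hσ.tendsto_atTop.eventually hLj] with j hj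
    exact hj v
  have hinj : Function.Injective L' := by
    rw [injective_iff_map_eq_zero]
    intro v hv
    by_contra h0
    have h2 := hinv v
    rw [hv, hg.map_zero] at h2
    exact (hg.pos v h0).ne h2
  -- The limit preserves `g u`, so composing with its inverse keeps the equivalences and makes them
  -- tend to the identity.
  set K := (LinearEquiv.ofInjectiveEndo L'.toLinearMap hinj).toContinuousLinearEquiv with hK
  have hKL : ∀ v, K v = L' v := fun v => rfl
  have hKinv : ∀ v, g u (K.symm v) = g u v := fun v => by
    rw [← hinv (K.symm v), ← hKL, K.apply_symm_apply]
  refine ⟨σ, fun j => (K.symm : Plane →L[ℝ] Plane) ∘L (L (σ j)) - .id ℝ Plane, hσ, ?_, ?_⟩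
  · have h2 : Tendsto (fun j => (K.symm : Plane →L[ℝ] Plane) ∘L (L (σ j)) - .id ℝ Plane) atTop
        (𝓝 ((K.symm : Plane →L[ℝ] Plane) ∘L L' - .id ℝ Plane)) := by
      have : Continuous fun S : Plane →L[ℝ] Plane =>
        (K.symm : Plane →L[ℝ] Plane) ∘L S - .id ℝ Plane := by fun_prop
      exact (this.tendsto _).comp hlim
    convert h2 using 2
    ext1 v
    simp [← hKL]
  · filter_upwards [hσ.tendsto_atTop.eventually hLj] with j hj
    intro v
    simp [hKinv, hj v]

/-- If all the functions `g u'` are linearly equivalent to `g u`, then the variation of `g` at `u`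
is induced by a linear vector field. -/
theorem NoTangentField.exists_variation [NormedSpace ℝ X] (hN : NoTangentField (g u))
    (hg : IsSquaredGauge (g u))
    (hL : ∀ᶠ u' in 𝓝 u, ∃ L : Plane →ₗ[ℝ] Plane, ∀ v, g u' v = g u (L v))
    (hd : ∀ v, v ≠ 0 → DifferentiableAt ℝ (fun u' => g u' v) u) (k : X) :
    ∃ Z : Plane →ₗ[ℝ] Plane, ∀ v, v ≠ 0 →
      fderiv ℝ (g u) v (Z v) = fderiv ℝ (fun u' => g u' v) u k := by
  set t : ℕ → ℝ := fun j => 1 / ((j : ℝ) + 1) with ht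
  have htpos : ∀ j, 0 < t j := fun j => Nat.one_div_pos_of_nat
  have htlim : Tendsto t atTop (𝓝 0) := tendsto_one_div_add_atTop_nhds_zero_nat
  have hxlim : Tendsto (fun j => u + t j • k) atTop (𝓝 u) := by
    simpa using tendsto_const_nhds.add (htlim.smul_const k)
  obtain ⟨σ, D, hσ, hD, hgD⟩ := exists_equivalences_tendsto_id hg hL
    (fun v hv => (hd v hv).continuousAt) hxlim
  -- It is not known that `D j = O(t (σ j))`. Dividing both by their sum keeps them bounded and
  -- makes the limits satisfy `τ + ‖Z‖ = 1`.
  set r : ℕ → ℝ := fun j => t (σ j) + ‖D j‖ with hr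
  have hrpos : ∀ j, 0 < r j := fun j => add_pos_of_pos_of_nonneg (htpos _) (norm_nonneg _)
  have hle1 : ∀ j, t (σ j) ≤ r j := fun j => le_add_of_nonneg_right (norm_nonneg _)
  have hle2 : ∀ j, ‖D j‖ ≤ r j := fun j => le_add_of_nonneg_left (htpos _).le
  obtain ⟨⟨τ, Z⟩, -, ψ, hψ, hlim⟩ := tendsto_subseq_of_bounded
    (Metric.isBounded_closedBall (x := (0 : ℝ × (Plane →L[ℝ] Plane))) (r := 1))
    (x := fun j => ((r j)⁻¹ * t (σ j), (r j)⁻¹ • D j)) (by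
      intro j
      have := hrpos j
      rw [mem_closedBall_zero_iff, Prod.norm_def]
      refine max_le ?_ ?_
      · simp only [norm_mul, norm_inv, Real.norm_eq_abs, abs_of_pos this, abs_of_pos (htpos _)]
        rw [inv_mul_le_iff₀ this, mul_one]
        exact hle1 j
      · simp only [norm_smul, norm_inv, Real.norm_eq_abs, abs_of_pos this]
        rw [inv_mul_le_iff₀ this, mul_one]
        exact hle2 j)
  have hτ : Tendsto (fun j => (r (ψ j))⁻¹ * t (σ (ψ j))) atTop (𝓝 τ) :=
    (continuous_fst.tendsto _).comp hlim
  have hZ : Tendsto (fun j => (r (ψ j))⁻¹ • D (ψ j)) atTop (𝓝 Z) :=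
    (continuous_snd.tendsto _).comp hlim
  have hsum : τ + ‖Z‖ = 1 := by
    refine tendsto_nhds_unique (hτ.add hZ.norm) (tendsto_const_nhds.congr fun j => ?_)
    have := hrpos (ψ j)
    rw [norm_smul, norm_inv, Real.norm_eq_abs, abs_of_pos this, ← mul_add]
    exact (inv_mul_cancel₀ this.ne').symm
  have hDψ : Tendsto (fun j => D (ψ j)) atTop (𝓝 0) := hD.comp hψ.tendsto_atTop
  have htψ : Tendsto (fun j => t (σ (ψ j))) atTop (𝓝 0) :=
    htlim.comp (hσ.tendsto_atTop.comp hψ.tendsto_atTop)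
  -- Both sides are limits of the same rescaled increments of `g`, computed once through the
  -- argument `v + D v` and once through the parameter `u + t k`.
  have key : ∀ v, v ≠ 0 →
      fderiv ℝ (g u) v (Z v) = τ * fderiv ℝ (fun u' => g u' v) u k := by
    intro v hv
    have h1 := (hasFDerivWithinAt_univ.2 (hg.differentiableAt hv).hasFDerivAt).lim
      (l := atTop) (c := fun j => (r (ψ j))⁻¹) (d := fun j => D (ψ j) v) (v := Z v)
      (((ContinuousLinearMap.apply ℝ Plane v).continuous.tendsto' 0 0 (by simp)).comp hDψ)
      (Eventually.of_forall fun _ => Set.mem_univ _)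
      (((ContinuousLinearMap.apply ℝ Plane v).continuous.tendsto Z).comp hZ)
    have h2 := (hasFDerivWithinAt_univ.2 (hd v hv).hasFDerivAt).lim
      (l := atTop) (c := fun j => (r (ψ j))⁻¹) (d := fun j => t (σ (ψ j)) • k) (v := τ • k)
      (by simpa using htψ.smul_const k)
      (Eventually.of_forall fun _ => Set.mem_univ _)
      (by simpa only [smul_smul] using hτ.smul_const k)
    rw [map_smul, smul_eq_mul] at h2
    refine tendsto_nhds_unique h1 (h2.congr' ?_)
    filter_upwards [hψ.tendsto_atTop.eventually hgD] with j hj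
    rw [hj v]
  -- If `τ = 0`, then `Z` is tangent to the level sets, hence zero, contradicting `τ + ‖Z‖ = 1`.
  have hτ0 : τ ≠ 0 := by
    intro h0
    have h1 : Z.toLinearMap = 0 := hN _ fun v hv => by simpa [h0] using key v hv
    have h2 : Z = 0 := by
      ext1 v
      exact LinearMap.congr_fun h1 v
    simp [h0, h2] at hsum
  refine ⟨τ⁻¹ • Z.toLinearMap, fun v hv => ?_⟩
  rw [LinearMap.smul_apply, map_smul, ContinuousLinearMap.coe_coe, key v hv, smul_eq_mul,
    inv_mul_cancel_left₀ hτ0]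

end Compactness

/-! ### Frames adapted to a tangent plane -/

section Frame

variable {V : Type*} [NormedAddCommGroup V] [NormedSpace ℝ V]

/-- The map `(w, t) ↦ A w + t n`. -/
def frame (A : Plane →L[ℝ] V) (n : V) : Plane × ℝ →L[ℝ] V :=
  A.coprod (ContinuousLinearMap.toSpanSingleton ℝ n)

theorem frame_apply (A : Plane →L[ℝ] V) (n : V) (w : Plane) (t : ℝ) :
    frame A n (w, t) = A w + t • n := by simp [frame]

/-- The tangential component of a vector with respect to a frame. -/
def tangentPart (A : Plane →L[ℝ] V) (n : V) : V →L[ℝ] Plane :=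
  ContinuousLinearMap.fst ℝ Plane ℝ ∘L (frame A n).inverse

/-- The normal component of a vector with respect to a frame. -/
def normalPart (A : Plane →L[ℝ] V) (n : V) : V →L[ℝ] ℝ :=
  ContinuousLinearMap.snd ℝ Plane ℝ ∘L (frame A n).inverse

variable {A : Plane →L[ℝ] V} {n : V}

theorem frame_decomp (hI : (frame A n).IsInvertible) (z : V) :
    z = A (tangentPart A n z) + normalPart A n z • n := by
  conv_lhs => rw [← hI.self_apply_inverse z]
  exact frame_apply A n _ _

theorem frame_inverse_apply (hI : (frame A n).IsInvertible) (w : Plane) (t : ℝ) :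
    (frame A n).inverse (A w + t • n) = (w, t) := by
  rw [← frame_apply, hI.inverse_apply_self]

theorem normalPart_apply (hI : (frame A n).IsInvertible) (w : Plane) (t : ℝ) :
    normalPart A n (A w + t • n) = t := by
  simp only [normalPart, ContinuousLinearMap.comp_apply, frame_inverse_apply hI]
  rfl

theorem frame_ne_zero (hI : (frame A n).IsInvertible) (w : Plane) : n - A w ≠ 0 := by
  intro h0
  have h1 := normalPart_apply hI (-w) 1
  rw [one_smul, map_neg, neg_add_eq_sub, h0, map_zero] at h1
  exact zero_ne_one h1

/-- Composition of a vector-valued bilinear form with the normal component. -/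
def normalForm (A : Plane →L[ℝ] V) (n : V) (Q : Plane →L[ℝ] Plane →L[ℝ] V) :
    Plane →L[ℝ] Plane →L[ℝ] ℝ :=
  ContinuousLinearMap.compL ℝ Plane V ℝ (normalPart A n) ∘L Q

@[simp] theorem normalForm_apply (Q : Plane →L[ℝ] Plane →L[ℝ] V) (v w : Plane) :
    normalForm A n Q v w = normalPart A n (Q v w) := rfl

theorem continuous_frame (n : V) : Continuous fun A : Plane →L[ℝ] V => frame A n := by
  have h1 : (fun A : Plane →L[ℝ] V => frame A n) = fun A =>
      A ∘L ContinuousLinearMap.fst ℝ Plane ℝ +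
        ContinuousLinearMap.toSpanSingleton ℝ n ∘L ContinuousLinearMap.snd ℝ Plane ℝ := by
    ext A z <;> simp [frame]
  rw [h1]
  fun_prop

theorem eventually_frame_isInvertible (hI : (frame A n).IsInvertible) :
    ∀ᶠ A' in 𝓝 A, (frame A' n).IsInvertible := by
  obtain ⟨e, he⟩ := hI
  have h1 : Set.range ((↑) : ((Plane × ℝ) ≃L[ℝ] V) → (Plane × ℝ) →L[ℝ] V) ∈ 𝓝 (frame A n) := by
    rw [← he]
    exact ContinuousLinearEquiv.nhds e
  exact (continuous_frame n).continuousAt h1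

theorem continuousAt_normalPart (hI : (frame A n).IsInvertible) :
    ContinuousAt (fun A' => normalPart A' n) A := by
  have h1 : ContinuousAt (fun A' => (frame A' n).inverse) A :=
    ContinuousAt.comp (g := ContinuousLinearMap.inverse) (f := fun A' => frame A' n)
      (hI.contDiffAt_map_inverse (n := 0)).continuousAt (continuous_frame n).continuousAt
  exact continuousAt_const.clm_comp h1

theorem continuousAt_formDet {X : Type*} [TopologicalSpace X] {x : X} {A : X → Plane →L[ℝ] V}
    {Q : X → Plane →L[ℝ] Plane →L[ℝ] V} (hA : ContinuousAt A x) (hQ : ContinuousAt Q x)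
    (hI : (frame (A x) n).IsInvertible) :
    ContinuousAt (fun y => formDet (normalForm (A y) n (Q y))) x := by
  have h1 : ContinuousAt (fun y => normalPart (A y) n) x :=
    ContinuousAt.comp (g := fun A' => normalPart A' n) (continuousAt_normalPart hI) hA
  have h2 : ∀ v w, ContinuousAt (fun y => normalForm (A y) n (Q y) v w) x := fun v w =>
    h1.clm_apply ((hQ.clm_apply continuousAt_const).clm_apply continuousAt_const)
  exact ((h2 _ _).mul (h2 _ _)).sub ((h2 _ _).mul (h2 _ _))

end Frame

/-! ### The non-Riemannian case -/

section Surface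

variable {V : Type*} [NormedAddCommGroup V] [NormedSpace ℝ V] {H : V → ℝ}

theorem hasFDerivAt_fderiv_comp_linear (hH : IsSquaredGauge H) {A : Plane →L[ℝ] V}
    (hA : ∀ v, v ≠ 0 → A v ≠ 0) {v : Plane} (hv : v ≠ 0) (z : V) :
    HasFDerivAt (fun v => fderiv ℝ H (A v) z)
      (((fderiv ℝ (fderiv ℝ H) (A v)) ∘L A).flip z) v := by
  have h1 : HasFDerivAt (fun v => fderiv ℝ H (A v)) ((fderiv ℝ (fderiv ℝ H) (A v)) ∘L A) v :=
    (hH.differentiableAt_fderiv (hA v hv)).hasFDerivAt.comp v A.hasFDerivAt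
  have h2 := h1.clm_apply (hasFDerivAt_const z v)
  refine h2.congr_fderiv ?_
  ext w
  simp

/-- This is the derivative in `v` of the identity `dH(Av) N = 0`. -/
theorem sndFDeriv_eq_zero (hH : IsSquaredGauge H) {A : Plane →L[ℝ] V}
    (hA : ∀ v, v ≠ 0 → A v ≠ 0) {N : V} (hN : ∀ v, v ≠ 0 → fderiv ℝ H (A v) N = 0)
    {v : Plane} (hv : v ≠ 0) (w : Plane) : fderiv ℝ (fderiv ℝ H) (A v) (A w) N = 0 := by
  have h1 := hasFDerivAt_fderiv_comp_linear hH hA hv N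
  have h2 : (fun v => fderiv ℝ H (A v) N) =ᶠ[𝓝 v] fun _ => 0 := by
    filter_upwards [isOpen_ne.mem_nhds hv] with x hx
    exact hN x hx
  have h3 := h1.unique ((hasFDerivAt_const (0 : ℝ) v).congr_of_eventuallyEq h2)
  exact DFunLike.congr_fun h3 w

/-- A smooth immersion `G` of an open set `U` of the plane such that the functions
`v ↦ H (dG v)` at all points of `U` are linearly equivalent. -/
structure IsMonochromaticImmersion (H : V → ℝ) (G : Plane → V) (U : Set Plane) : Prop where
  isOpen : IsOpen U
  contDiffAt : ∀ u ∈ U, ContDiffAt ℝ ∞ G u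
  injective : ∀ u ∈ U, ∀ v, v ≠ 0 → fderiv ℝ G u v ≠ 0
  equiv : ∀ u ∈ U, ∀ u' ∈ U, ∃ L : Plane →ₗ[ℝ] Plane, ∀ v,
    H (fderiv ℝ G u' v) = H (fderiv ℝ G u (L v))

namespace IsMonochromaticImmersion

variable {G : Plane → V} {U : Set Plane}

theorem contDiffAt_fderiv (hG : IsMonochromaticImmersion H G U) {u : Plane} (hu : u ∈ U) :
    ContDiffAt ℝ ∞ (fderiv ℝ G) u :=
  (hG.contDiffAt u hu).fderiv_right (m := ∞) (by simp)

theorem contDiffAt_fderiv_fderiv (hG : IsMonochromaticImmersion H G U) {u : Plane}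
    (hu : u ∈ U) : ContDiffAt ℝ ∞ (fderiv ℝ (fderiv ℝ G)) u :=
  (hG.contDiffAt_fderiv hu).fderiv_right (m := ∞) (by simp)

theorem hasFDerivAt_fderiv (hG : IsMonochromaticImmersion H G U) {u : Plane} (hu : u ∈ U) :
    HasFDerivAt (fderiv ℝ G) (fderiv ℝ (fderiv ℝ G) u) u :=
  ((hG.contDiffAt_fderiv hu).differentiableAt (by simp)).hasFDerivAt

theorem hasFDerivAt_fderiv_apply (hG : IsMonochromaticImmersion H G U) {u : Plane} (hu : u ∈ U)
    (v : Plane) :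
    HasFDerivAt (fun u => fderiv ℝ G u v) ((fderiv ℝ (fderiv ℝ G) u).flip v) u := by
  refine ((hG.hasFDerivAt_fderiv hu).clm_apply (hasFDerivAt_const v u)).congr_fderiv ?_
  ext w
  simp

theorem isSquaredGauge (hG : IsMonochromaticImmersion H G U) (hH : IsSquaredGauge H) {u : Plane}
    (hu : u ∈ U) : IsSquaredGauge fun v => H (fderiv ℝ G u v) :=
  hH.comp _ (hG.injective u hu)

/-- The first variation of the metric. -/
theorem hasFDerivAt_metric (hG : IsMonochromaticImmersion H G U) (hH : IsSquaredGauge H)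
    {u : Plane} (hu : u ∈ U) {v : Plane} (hv : v ≠ 0) :
    HasFDerivAt (fun u => H (fderiv ℝ G u v))
      (fderiv ℝ H (fderiv ℝ G u v) ∘L (fderiv ℝ (fderiv ℝ G) u).flip v) u :=
  (hH.differentiableAt (hG.injective u hu v hv)).hasFDerivAt.comp u
    (hG.hasFDerivAt_fderiv_apply hu v)

theorem hasFDerivAt_fderiv_gauge (hG : IsMonochromaticImmersion H G U) (hH : IsSquaredGauge H)
    {u : Plane} (hu : u ∈ U) {v : Plane} (hv : v ≠ 0) :
    HasFDerivAt (fun u => fderiv ℝ H (fderiv ℝ G u v))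
      (fderiv ℝ (fderiv ℝ H) (fderiv ℝ G u v) ∘L (fderiv ℝ (fderiv ℝ G) u).flip v) u :=
  (hH.differentiableAt_fderiv (hG.injective u hu v hv)).hasFDerivAt.comp u
    (hG.hasFDerivAt_fderiv_apply hu v)

/-- At a point where the metric is not a quadratic form and the second fundamental form is
nondegenerate, there is a transverse direction with planar shadow boundary. -/
theorem exists_normal (hG : IsMonochromaticImmersion H G U) (hH : IsSquaredGauge H)
    {u : Plane} (hu : u ∈ U) {n : V} (hI : (frame (fderiv ℝ G u) n).IsInvertible)
    (hb : formDet (normalForm (fderiv ℝ G u) n (fderiv ℝ (fderiv ℝ G) u)) ≠ 0)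
    (hN : NoTangentField fun v => H (fderiv ℝ G u v)) :
    ∃ x, ∀ v, v ≠ 0 → fderiv ℝ H (fderiv ℝ G u v) (n - fderiv ℝ G u x) = 0 := by
  set A := fderiv ℝ G u with hA
  set Q := fderiv ℝ (fderiv ℝ G) u with hQ
  have hAi := hG.injective u hu
  have hg := hG.isSquaredGauge hH hu
  have hX : ∀ k, ∃ X : Plane →ₗ[ℝ] Plane, ∀ v, v ≠ 0 →
      fderiv ℝ H (A v) (A (X v)) = normalForm A n Q k v * fderiv ℝ H (A v) n := by
    intro k
    obtain ⟨Z, hZ⟩ := NoTangentField.exists_variation (g := fun u v => H (fderiv ℝ G u v)) hN hg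
      (by
        filter_upwards [hG.isOpen.mem_nhds hu] with u' hu'
        exact hG.equiv u hu u' hu')
      (fun v hv => (hG.hasFDerivAt_metric hH hu hv).differentiableAt) k
    -- The variation of the metric is `dH(Av)(Q k v)`. It equals `dH(Av)(A (Z v))`; removing the
    -- tangential part of `Q k v` leaves its normal part.
    refine ⟨Z - (tangentPart A n ∘L Q k).toLinearMap, fun v hv => ?_⟩
    have h1 := hZ v hv
    rw [fderiv_comp_linear hH hAi hv, (hG.hasFDerivAt_metric hH hu hv).fderiv] at h1
    have h2 := congrArg (fderiv ℝ H (A v)) (frame_decomp hI (Q k v))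
    simp only [map_add, map_smul, smul_eq_mul] at h2
    simp only [LinearMap.sub_apply, map_sub, ContinuousLinearMap.coe_coe,
      ContinuousLinearMap.comp_apply, ContinuousLinearMap.flip_apply, normalForm_apply] at h1 ⊢
    rw [h1, ← hQ, h2]
    ring
  obtain ⟨X, hX0⟩ := hX e₀
  obtain ⟨Y, hY0⟩ := hX e₁
  exact hN.exists_normal hH hAi hb hX0 hY0

/-- A monochromatic immersion with nondegenerate second fundamental form induces a Riemannian
metric. -/
theorem isQuad_of_nondegenerate (hG : IsMonochromaticImmersion H G U) (hH : IsSquaredGauge H)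
    (hconv : ∀ z, z ≠ 0 → ∀ w, w ≠ 0 → 0 < fderiv ℝ (fderiv ℝ H) z w w)
    {u : Plane} (hu : u ∈ U) {n : V} (hI : (frame (fderiv ℝ G u) n).IsInvertible)
    (hb : formDet (normalForm (fderiv ℝ G u) n (fderiv ℝ (fderiv ℝ G) u)) ≠ 0) :
    IsQuad fun v => H (fderiv ℝ G u v) := by
  by_contra hquad
  have hcont : ContinuousAt (fderiv ℝ G) u := (hG.contDiffAt_fderiv hu).continuousAt
  -- Invertibility of the frame and nondegeneracy are open conditions, and not being quadratic
  -- passes to all points through the linear equivalences.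
  have hnorm : ∀ᶠ u' in 𝓝 u, ∃ x, ∀ v, v ≠ 0 →
      fderiv ℝ H (fderiv ℝ G u' v) (n - fderiv ℝ G u' x) = 0 := by
    filter_upwards [hG.isOpen.mem_nhds hu, hcont.eventually (eventually_frame_isInvertible hI),
      (continuousAt_formDet hcont (hG.contDiffAt_fderiv_fderiv hu).continuousAt hI).eventually_ne
        hb] with u' hu' hI' hb'
    refine hG.exists_normal hH hu' hI' hb' (noTangentField_of_not_isQuad
      (hG.isSquaredGauge hH hu') fun hq => hquad ?_)
    obtain ⟨L, hL⟩ := hG.equiv u' hu' u hu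
    simpa only [← hL] using hq.comp L
  obtain ⟨x, hx⟩ : ∃ x : Plane → Plane, ∀ᶠ u' in 𝓝 u, ∀ v, v ≠ 0 →
      fderiv ℝ H (fderiv ℝ G u' v) (n - fderiv ℝ G u' (x u')) = 0 := hnorm.choice
  set A := fderiv ℝ G u with hA
  set Q := fderiv ℝ (fderiv ℝ G) u with hQ
  have hAi : ∀ v, v ≠ 0 → A v ≠ 0 := hG.injective u hu
  have hg : IsSquaredGauge fun v => H (A v) := hG.isSquaredGauge hH hu
  have hdx : DifferentiableAt ℝ x u := by
    -- The conditions at `v = e₀` and `v = v₂` form a linear system for `x u'` with differentiable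
    -- coefficients, solved by Cramer's rule. This `v₂` makes the determinant at `u` equal to
    -- `dH(Av₂)(Av₂) = 2 H(Av₂) > 0`.
    set v₂ : Plane := !₂[-fderiv ℝ H (A e₀) (A e₁), fderiv ℝ H (A e₀) (A e₀)] with hv₂
    set M : Plane → Plane → Plane → ℝ := fun v w u' =>
      fderiv ℝ H (fderiv ℝ G u' v) (fderiv ℝ G u' w) with hM
    set r : Plane → Plane → ℝ := fun v u' => fderiv ℝ H (fderiv ℝ G u' v) n with hr
    have h00 : M e₀ e₀ u ≠ 0 := by
      simp only [hM, ← hA, hH.fderiv_self (hAi _ e₀_ne_zero)]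
      exact mul_ne_zero two_ne_zero (hH.pos _ (hAi _ e₀_ne_zero)).ne'
    have hv₂0 : v₂ ≠ 0 := ne_zero_iff.2 (Or.inr h00)
    have hMd : ∀ v, v ≠ 0 → ∀ w, DifferentiableAt ℝ (M v w) u := fun v hv w =>
      ((hG.hasFDerivAt_fderiv_gauge hH hu hv).clm_apply
        (hG.hasFDerivAt_fderiv_apply hu w)).differentiableAt
    have hrd : ∀ v, v ≠ 0 → DifferentiableAt ℝ (r v) u := fun v hv =>
      ((hG.hasFDerivAt_fderiv_gauge hH hu hv).clm_apply
        (hasFDerivAt_const n u)).differentiableAt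
    set δ : Plane → ℝ := fun u' => M e₀ e₀ u' * M v₂ e₁ u' - M e₀ e₁ u' * M v₂ e₀ u' with hδ
    have hδd : DifferentiableAt ℝ δ u :=
      ((hMd _ e₀_ne_zero _).mul (hMd _ hv₂0 _)).sub ((hMd _ e₀_ne_zero _).mul (hMd _ hv₂0 _))
    have hδ0 : δ u ≠ 0 := by
      have h1 : δ u = 2 * H (A v₂) := by
        rw [← hH.fderiv_self (hAi v₂ hv₂0)]
        have h2 := linearMap_apply (fderiv ℝ H (A v₂) ∘L A).toLinearMap v₂
        simp only [ContinuousLinearMap.coe_coe, ContinuousLinearMap.comp_apply, smul_eq_mul] at h2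
        have h3 : v₂ 0 = -M e₀ e₁ u := rfl
        have h4 : v₂ 1 = M e₀ e₀ u := rfl
        rw [hA] at h2 ⊢
        rw [h2, h3, h4]
        simp only [hδ, hM]
        ring
      rw [h1]
      exact mul_ne_zero two_ne_zero (hH.pos _ (hAi _ hv₂0)).ne'
    have hsol : x =ᶠ[𝓝 u] fun u' => (δ u')⁻¹ • ((r e₀ u' * M v₂ e₁ u' - M e₀ e₁ u' * r v₂ u') • e₀
        + (M e₀ e₀ u' * r v₂ u' - r e₀ u' * M v₂ e₀ u') • e₁) := by
      filter_upwards [hx, hδd.continuousAt.eventually_ne hδ0] with u' h1 h2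
      have h3 : ∀ v, v ≠ 0 → r v u' = x u' 0 * M v e₀ u' + x u' 1 * M v e₁ u' := by
        intro v hv
        have := h1 v hv
        rw [map_sub, sub_eq_zero] at this
        simp only [hr, this, hM]
        conv_lhs => rw [eq_comb (x u')]
        simp
      rw [h3 _ e₀_ne_zero, h3 _ hv₂0]
      apply Plane.ext
      · simp
        field_simp
        simp only [hδ]
        ring
      · simp
        field_simp
        simp only [hδ]
        ring
    refine DifferentiableAt.congr_of_eventuallyEq ?_ hsol
    have d1 := hMd _ e₀_ne_zero e₀
    have d2 := hMd _ e₀_ne_zero e₁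
    have d3 := hMd _ hv₂0 e₀
    have d4 := hMd _ hv₂0 e₁
    have d5 := hrd _ e₀_ne_zero
    have d6 := hrd _ hv₂0
    have d7 := hδd.fun_inv hδ0
    fun_prop
  set N := n - A (x u) with hN
  have hN0 : N ≠ 0 := frame_ne_zero hI _
  have hNv : ∀ v, v ≠ 0 → fderiv ℝ H (A v) N = 0 := hx.self_of_nhds
  set b := normalForm A n Q with hb'
  set N' : Plane → V := fun k => -(Q k (x u) + A (fderiv ℝ x u k)) with hN'
  have hQN : ∀ k v, Q k v = A (tangentPart A n (Q k v) + b k v • x u) + b k v • N := by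
    intro k v
    conv_lhs => rw [frame_decomp hI (Q k v)]
    simp only [hb', normalForm_apply, hN, map_add, map_smul]
    module
  -- Differentiation in the base point, in direction `k`, of the conjugacy relation; `N' k` is the
  -- derivative of the moving transverse vector.
  have hvar : ∀ k v, v ≠ 0 →
      fderiv ℝ (fderiv ℝ H) (A v) (Q k v) N + fderiv ℝ H (A v) (N' k) = 0 := by
    intro k v hv
    have h1 : HasFDerivAt (fun u' => n - fderiv ℝ G u' (x u'))
        (-(A ∘L fderiv ℝ x u + Q.flip (x u))) u := by
      refine ((hasFDerivAt_const n u).sub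
        ((hG.hasFDerivAt_fderiv hu).clm_apply hdx.hasFDerivAt)).congr_fderiv ?_
      ext w
      simp [hA, hQ]
    have h2 := (hG.hasFDerivAt_fderiv_gauge hH hu hv).clm_apply h1
    have h3 := h2.unique ((hasFDerivAt_const (0 : ℝ) u).congr_of_eventuallyEq
      (hx.mono fun u' h => h v hv))
    have h4 := DFunLike.congr_fun h3 k
    simp only [add_apply, ContinuousLinearMap.comp_apply,
      ContinuousLinearMap.flip_apply, neg_apply, zero_apply,
      ← hA, ← hQ, ← hN] at h4
    rw [← h4, hN', add_comm]
    congr 2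
    rw [add_comm]
  set c : Plane → ℝ := fun v => fderiv ℝ (fderiv ℝ H) (A v) N N with hc
  have hbc : ∀ k v, v ≠ 0 → b k v * c v = -fderiv ℝ H (A v) (N' k) := by
    intro k v hv
    have h1 := hvar k v hv
    rw [hQN k v, map_add, map_smul, add_apply, sndFDeriv_eq_zero hH hAi hNv hv] at h1
    simp only [smul_apply, smul_eq_mul, zero_add] at h1
    simp only [hc]
    linarith
  -- Modulo `N`, which `dH(Av)` kills, the vector `N' k` is tangent.
  have hm : ∀ k, ∃ m : Plane, ∀ v, v ≠ 0 → fderiv ℝ H (A v) (N' k) = fderiv ℝ H (A v) (A m) := by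
    intro k
    refine ⟨tangentPart A n (N' k) + normalPart A n (N' k) • x u, fun v hv => ?_⟩
    have h1 : N' k = A (tangentPart A n (N' k) + normalPart A n (N' k) • x u)
        + normalPart A n (N' k) • N := by
      conv_lhs => rw [frame_decomp hI (N' k)]
      simp only [hN, map_add, map_smul]
      module
    conv_lhs => rw [h1]
    rw [map_add, map_smul, hNv v hv, smul_zero, add_zero]
  obtain ⟨m₀, hm₀⟩ := hm e₀
  obtain ⟨m₁, hm₁⟩ := hm e₁
  -- Eliminating `c v` between the relations for `e₀` and `e₁` produces a tangent linear field. Its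
  -- vanishing, tested on the dual basis, gives `m₀ = m₁ = 0`.
  have hZ : (b e₁).toLinearMap.smulRight m₀ - (b e₀).toLinearMap.smulRight m₁ = 0 := by
    refine noTangentField_of_not_isQuad hg hquad _ fun v hv => ?_
    rw [fderiv_comp_linear hH hAi hv]
    simp only [LinearMap.sub_apply, LinearMap.smulRight_apply, ContinuousLinearMap.coe_coe,
      map_sub, map_smul, smul_eq_mul, ← hm₀ v hv, ← hm₁ v hv]
    linear_combination b e₁ v * hbc e₀ v hv - b e₀ v * hbc e₁ v hv
  obtain ⟨k₀, k₁, h00, h01, h10, h11⟩ := exists_dual hb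
  have hm₀0 : m₀ = 0 := by
    have := LinearMap.congr_fun hZ k₁
    simpa [h01, h11] using this
  have hm₁0 : m₁ = 0 := by
    have := LinearMap.congr_fun hZ k₀
    simpa [h00, h10] using this
  have hcpos : ∀ v, v ≠ 0 → c v ≠ 0 := fun v hv => (hconv _ (hAi v hv) _ hN0).ne'
  have hb0 : ∀ v, v ≠ 0 → b e₀ v = 0 ∧ b e₁ v = 0 := by
    intro v hv
    have h1 := hbc e₀ v hv
    have h2 := hbc e₁ v hv
    rw [hm₀ v hv, hm₀0, map_zero, map_zero, neg_zero] at h1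
    rw [hm₁ v hv, hm₁0, map_zero, map_zero, neg_zero] at h2
    exact ⟨(mul_eq_zero.1 h1).resolve_right (hcpos v hv),
      (mul_eq_zero.1 h2).resolve_right (hcpos v hv)⟩
  rcases exists_ne_zero_of_formDet hb e₀_ne_zero with h | h
  · exact h (hb0 _ e₀_ne_zero).1
  · exact h (hb0 _ e₀_ne_zero).2

end IsMonochromaticImmersion

end Surface

/-! ### Division by linear forms, the Koszul argument, families of quadratic forms -/

namespace Plane

theorem polar_self (a b c : ℝ) (v : Plane) : polar a b c v v = quad a b c v := by
  simp only [polar, quad]; ring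

theorem polar_comm (a b c : ℝ) (v w : Plane) : polar a b c v w = polar a b c w v := by
  simp only [polar]; ring

theorem polar_add (a b c : ℝ) (v w w' : Plane) :
    polar a b c v (w + w') = polar a b c v w + polar a b c v w' := by
  simp only [polar, PiLp.add_apply]; ring

theorem polar_smul (a b c r : ℝ) (v w : Plane) :
    polar a b c v (r • w) = r * polar a b c v w := by
  simp only [polar, PiLp.smul_apply, smul_eq_mul]; ring

theorem add_polar (a b c : ℝ) (v v' w : Plane) :
    polar a b c (v + v') w = polar a b c v w + polar a b c v' w := by
  simp only [polar, PiLp.add_apply]; ring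

theorem polar_sub (a b c : ℝ) (v w w' : Plane) :
    polar a b c v (w - w') = polar a b c v w - polar a b c v w' := by
  simp only [polar, PiLp.sub_apply]; ring

theorem quad_comb (a b c s t : ℝ) (v w : Plane) : quad a b c (s • v + t • w) =
    s ^ 2 * quad a b c v + 2 * s * t * polar a b c v w + t ^ 2 * quad a b c w := by
  simp [polar, quad]; ring

theorem isQuad_polar (a b c : ℝ) (L M : Plane →ₗ[ℝ] Plane) :
    IsQuad fun v => polar a b c (L v) (M v) := by
  refine ⟨polar a b c (L e₀) (M e₀), polar a b c (L e₀) (M e₁) + polar a b c (L e₁) (M e₀),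
    polar a b c (L e₁) (M e₁), ?_⟩
  ext v
  rw [linearMap_apply L v, linearMap_apply M v]
  simp [quad, polar]
  ring

theorem IsQuad.sub {q r : Plane → ℝ} (hq : IsQuad q) (hr : IsQuad r) :
    IsQuad fun v => q v - r v := by
  obtain ⟨a, b, c, rfl⟩ := hq
  obtain ⟨a', b', c', rfl⟩ := hr
  exact ⟨a - a', b - b', c - c', by ext v; simp only [quad]; ring⟩

theorem IsQuad.const_mul {q : Plane → ℝ} (hq : IsQuad q) (r : ℝ) : IsQuad fun v => r * q v := by
  obtain ⟨a, b, c, rfl⟩ := hq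
  exact ⟨r * a, r * b, r * c, by ext v; simp only [quad]; ring⟩

/-- A basis of the plane adapted to a nonzero linear form. -/
theorem exists_adapted {l : Plane →ₗ[ℝ] ℝ} (hl : l ≠ 0) :
    ∃ (w₀ w₁ : Plane) (s : Plane →ₗ[ℝ] ℝ), l w₀ = 0 ∧ l w₁ = 1 ∧ s w₀ = 1 ∧ s w₁ = 0 ∧
      ∀ v, v = s v • w₀ + l v • w₁ := by
  have hc : (!₂[l e₀, l e₁] : Plane) ≠ 0 := by
    intro h0
    refine hl (LinearMap.ext fun v => ?_)
    have h1 : l e₀ = 0 := congrArg (fun v : Plane => v 0) h0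
    have h2 : l e₁ = 0 := congrArg (fun v : Plane => v 1) h0
    rw [linearMap_apply l v, h1, h2]
    simp
  set N := l e₀ ^ 2 + l e₁ ^ 2 with hN
  have hN0 : N ≠ 0 := (sq_pos hc).ne'
  refine ⟨!₂[-l e₁, l e₀], N⁻¹ • !₂[l e₀, l e₁], N⁻¹ • areaLeft !₂[l e₀, l e₁],
    ?_, ?_, ?_, ?_, ?_⟩
  · rw [linearMap_apply l]; simp; ring
  · rw [map_smul, linearMap_apply l]; simp; field_simp; rw [hN]
  · simp [areaLeft_apply, area]; field_simp; ring
  · simp [areaLeft_apply, area]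
    right
    ring
  · intro v
    rw [linearMap_apply l v]
    apply Plane.ext <;> simp [areaLeft_apply, area] <;> field_simp <;> simp only [hN] <;> ring

/-- A function whose product with a nonzero linear form is quadratic is linear. -/
theorem exists_linear_of_isQuad_mul {l : Plane →ₗ[ℝ] ℝ} (hl : l ≠ 0) {f : Plane → ℝ}
    (hf : ∀ v, v ≠ 0 → ContinuousAt f v) (hq : IsQuad fun v => l v * f v) :
    ∃ m : Plane →ₗ[ℝ] ℝ, ∀ v, v ≠ 0 → f v = m v := by
  obtain ⟨w₀, w₁, s, h0, h1, h2, h3, hs⟩ := exists_adapted hl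
  obtain ⟨a, b, c, hq⟩ := hq
  replace hq : ∀ v, l v * f v = quad a b c v := fun v => congrFun hq v
  refine ⟨(2 * polar a b c w₀ w₁) • s + quad a b c w₁ • l, fun v hv => ?_⟩
  refine sub_eq_zero.1 (eq_zero_of_eq_zero_off_ker hl (f := fun v =>
    f v - ((2 * polar a b c w₀ w₁) • s + quad a b c w₁ • l) v) (fun v hv => (hf v hv).sub
      (LinearMap.continuous_of_finiteDimensional _).continuousAt) (fun v hlv => ?_) v hv)
  apply mul_left_cancel₀ hlv
  -- The quadratic form vanishes on the kernel of `l`, hence is `l` times a linear form.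
  have h4 : quad a b c w₀ = 0 := by rw [← hq, h0, zero_mul]
  have h5 := hq v
  conv_rhs at h5 => rw [hs v, quad_comb, h4]
  simp only [LinearMap.add_apply, LinearMap.smul_apply, smul_eq_mul, mul_sub, h5]
  ring

/-- A positive function whose product with the square of a nonzero linear form is quadratic is
constant. -/
theorem exists_const_of_isQuad_sq_mul {l : Plane →ₗ[ℝ] ℝ} (hl : l ≠ 0) {f : Plane → ℝ}
    (hf : ∀ v, v ≠ 0 → ContinuousAt f v) (hpos : ∀ v, v ≠ 0 → 0 < f v)
    (hq : IsQuad fun v => l v * l v * f v) : ∃ γ : ℝ, 0 < γ ∧ ∀ v, v ≠ 0 → f v = γ := by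
  obtain ⟨w₀, w₁, s, h0, h1, h2, h3, hs⟩ := exists_adapted hl
  obtain ⟨a, b, c, hq⟩ := hq
  replace hq : ∀ v, l v * l v * f v = quad a b c v := fun v => congrFun hq v
  have hw₁ : w₁ ≠ 0 := by rintro rfl; simp at h1
  have h4 : quad a b c w₀ = 0 := by rw [← hq, h0, zero_mul, zero_mul]
  have h5 : ∀ v, l v * l v * f v =
      2 * s v * l v * polar a b c w₀ w₁ + l v ^ 2 * quad a b c w₁ := by
    intro v
    have h5 := hq v
    conv_rhs at h5 => rw [hs v, quad_comb, h4]
    rw [h5]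
    ring
  have h6 : polar a b c w₀ w₁ = 0 := by
    by_contra hP
    -- On the line `l = 1` the function `f` is affine in `r`; this value of `r` would give `f = -1`.
    set r := -(quad a b c w₁ + 1) / (2 * polar a b c w₀ w₁) with hr
    have hl1 : l (r • w₀ + w₁) = 1 := by simp [h0, h1]
    have hs1 : s (r • w₀ + w₁) = r := by simp [h2, h3]
    have h7 := h5 (r • w₀ + w₁)
    rw [hl1, hs1] at h7
    have h8 := hpos (r • w₀ + w₁) (by intro h; rw [h] at hl1; simp at hl1)
    have h9 : 2 * r * polar a b c w₀ w₁ = -(quad a b c w₁ + 1) := by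
      rw [hr]; field_simp
    linarith
  have h7 : f w₁ = quad a b c w₁ := by rw [← hq, h1]; ring
  refine ⟨f w₁, hpos _ hw₁, fun v hv => ?_⟩
  refine sub_eq_zero.1 (eq_zero_of_eq_zero_off_ker hl (f := fun v => f v - f w₁)
    (fun v hv => (hf v hv).sub continuousAt_const) (fun v hlv => ?_) v hv)
  apply mul_left_cancel₀ (mul_ne_zero hlv hlv)
  rw [mul_sub, h5, h6, h7]
  ring

/-- Every linear form is represented by a vector with respect to a definite quadratic form. -/
theorem exists_polar_eq {a b c : ℝ} (hpos : ∀ v, v ≠ 0 → 0 < quad a b c v)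
    (m : Plane →ₗ[ℝ] ℝ) : ∃ x, ∀ v, m v = 2 * polar a b c v x := by
  let P : Plane →ₗ[ℝ] Plane :=
    { toFun := fun x => !₂[2 * polar a b c e₀ x, 2 * polar a b c e₁ x]
      map_add' := fun x y => by apply Plane.ext <;> simp [polar_add, mul_add]
      map_smul' := fun r x => by
        apply Plane.ext <;> simp [polar_smul] <;> ring }
  have hP : ∀ x v, 2 * polar a b c v x = v 0 * P x 0 + v 1 * P x 1 := by
    intro x v
    simp [P, polar]
    ring
  have hinj : Function.Injective P := by
    rw [injective_iff_map_eq_zero]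
    intro x hx
    by_contra h0
    have h1 := hP x x
    rw [polar_self, hx] at h1
    have h2 := hpos x h0
    simp at h1
    linarith
  obtain ⟨x, hx⟩ := LinearMap.injective_iff_surjective.1 hinj !₂[m e₀, m e₁]
  refine ⟨x, fun v => ?_⟩
  rw [hP, hx, linearMap_apply m v]
  simp

/-- The Koszul argument: a symmetric connection form is determined by the first derivatives of the
metric. -/
theorem eq_of_polar_eq {a b c : ℝ} (hpos : ∀ v, v ≠ 0 → 0 < quad a b c v)
    {Γ Γ' : Plane →L[ℝ] Plane →L[ℝ] Plane} (hs : ∀ v w, Γ v w = Γ w v)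
    (hs' : ∀ v w, Γ' v w = Γ' w v)
    (h : ∀ k v, polar a b c v (Γ k v) = polar a b c v (Γ' k v)) (v w : Plane) :
    Γ v w = Γ' v w := by
  set D := Γ - Γ' with hD
  have hDs : ∀ v w, D v w = D w v := fun v w => by
    simp only [hD, sub_apply, hs v w, hs' v w]
  have h0 : ∀ k v, polar a b c v (D k v) = 0 := fun k v => by
    simp only [hD, sub_apply, polar_sub, h k v, sub_self]
  have h1 : ∀ k v w, polar a b c v (D k w) = -polar a b c w (D k v) := by
    intro k v w
    have := h0 k (v + w)
    rw [map_add, polar_add, add_polar, add_polar, h0, h0] at this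
    linarith
  -- A trilinear form skew in one pair of arguments and symmetric in an overlapping pair is zero.
  have h2 : ∀ k v w, polar a b c v (D k w) = 0 := by
    intro k v w
    have e1 := h1 k v w
    have e2 := h1 v w k
    have e3 := h1 w k v
    rw [hDs v k] at e2
    rw [hDs w v] at e3
    rw [hDs w k] at e3
    linarith
  by_contra hne
  have h3 : D v w ≠ 0 := by
    simpa only [hD, sub_apply] using sub_ne_zero.2 hne
  have h4 := hpos _ h3
  rw [← polar_self, h2] at h4
  exact lt_irrefl _ h4

/-- A derivative of a family of quadratic forms is a quadratic form. -/
theorem isQuad_fderiv {X : Type*} [NormedAddCommGroup X] [NormedSpace ℝ X]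
    {g : X → Plane → ℝ} {u : X} (hg : ∀ᶠ u' in 𝓝 u, IsQuad (g u'))
    (hd : ∀ v, DifferentiableAt ℝ (fun u => g u v) u) (k : X) :
    IsQuad fun v => fderiv ℝ (fun u => g u v) u k := by
  -- Being quadratic is a linear relation among values at fixed vectors, so it survives
  -- differentiation in the parameter.
  rw [isQuad_iff]
  intro v
  have h1 : (fun u => g u v) =ᶠ[𝓝 u] fun u => v 0 ^ 2 * g u e₀
      + v 0 * v 1 * (g u (e₀ + e₁) - g u e₀ - g u e₁) + v 1 ^ 2 * g u e₁ :=
    hg.mono fun u' hu' => isQuad_iff.1 hu' v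
  have h2 := (hd e₀).hasFDerivAt
  have h3 := (hd e₁).hasFDerivAt
  have h4 := (hd (e₀ + e₁)).hasFDerivAt
  rw [h1.fderiv_eq, (((h2.const_mul (v 0 ^ 2)).fun_add
    (((h4.fun_sub h2).fun_sub h3).const_mul (v 0 * v 1))).fun_add (h3.const_mul (v 1 ^ 2))).fderiv]
  simp

end Plane

/-! ### The Riemannian case: Gauss equation and theorema egregium -/

section GaussEquation

theorem minSmoothness_two_le : minSmoothness ℝ 2 ≤ ∞ := by
  rw [minSmoothness_of_isRCLikeNormedField]
  exact ENat.LEInfty.out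

variable {V : Type*} [NormedAddCommGroup V] [NormedSpace ℝ V] {H : V → ℝ}

/-- The combination of second derivatives of a family of functions on the plane that enters the
Gauss curvature. -/
def curvatureTerm (g : Plane → Plane → ℝ) (u : Plane) : ℝ :=
  let S : Plane → Plane → Plane → ℝ := fun k l v =>
    fderiv ℝ (fun u' => fderiv ℝ (fun u'' => g u'' v) u' k) u l
  -- For quadratic `g` this is `∂₁∂₁g₀₀ + ∂₀∂₀g₁₁ - 2∂₀∂₁g₀₁`, the last term being obtained by
  -- polarization.
  S e₁ e₁ e₀ + S e₀ e₀ e₁ - (S e₀ e₁ (e₀ + e₁) - S e₀ e₁ e₀ - S e₀ e₁ e₁)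

theorem Filter.EventuallyEq.curvatureTerm_eq {g g' : Plane → Plane → ℝ} {u : Plane}
    (h : g =ᶠ[𝓝 u] g') : curvatureTerm g u = curvatureTerm g' u := by
  have h1 : ∀ k l v, fderiv ℝ (fun u' => fderiv ℝ (fun u'' => g u'' v) u' k) u l =
      fderiv ℝ (fun u' => fderiv ℝ (fun u'' => g' u'' v) u' k) u l := by
    intro k l v
    have h2 : (fun u' => fderiv ℝ (fun u'' => g u'' v) u' k) =ᶠ[𝓝 u]
        fun u' => fderiv ℝ (fun u'' => g' u'' v) u' k := by
      filter_upwards [h.eventuallyEq_nhds] with u' hu'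
      have h3 : (fun u'' => g u'' v) =ᶠ[𝓝 u'] fun u'' => g' u'' v :=
        hu'.mono fun x hx => congrFun hx v
      rw [h3.fderiv_eq]
    rw [h2.fderiv_eq]
  simp only [curvatureTerm, h1]

namespace IsMonochromaticImmersion

variable {G : Plane → V} {U : Set Plane}

theorem eventually_mem (hG : IsMonochromaticImmersion H G U) {u : Plane} (hu : u ∈ U) :
    ∀ᶠ u' in 𝓝 u, u' ∈ U :=
  hG.isOpen.mem_nhds hu

theorem fderiv_fderiv_comm (hG : IsMonochromaticImmersion H G U) {u : Plane} (hu : u ∈ U)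
    (k v : Plane) : fderiv ℝ (fderiv ℝ G) u k v = fderiv ℝ (fderiv ℝ G) u v k :=
  (hG.contDiffAt u hu).isSymmSndFDerivAt minSmoothness_two_le k v

theorem hasFDerivAt_fderiv_fderiv_apply (hG : IsMonochromaticImmersion H G U) {u : Plane}
    (hu : u ∈ U) (k v : Plane) :
    HasFDerivAt (fun u => fderiv ℝ (fderiv ℝ G) u k v)
      (((fderiv ℝ (fderiv ℝ (fderiv ℝ G)) u).flip k).flip v) u := by
  have h1 := ((hG.contDiffAt_fderiv_fderiv hu).differentiableAt (by simp)).hasFDerivAt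
  refine ((h1.clm_apply (hasFDerivAt_const k u)).clm_apply (hasFDerivAt_const v u)).congr_fderiv ?_
  ext w
  simp

theorem fderiv_fderiv_fderiv_comm (hG : IsMonochromaticImmersion H G U) {u : Plane} (hu : u ∈ U)
    (l k v : Plane) :
    fderiv ℝ (fderiv ℝ (fderiv ℝ G)) u l k v = fderiv ℝ (fderiv ℝ (fderiv ℝ G)) u k l v := by
  have := (hG.contDiffAt_fderiv hu).isSymmSndFDerivAt minSmoothness_two_le l k
  exact DFunLike.congr_fun this v

theorem fderiv_fderiv_fderiv_comm' (hG : IsMonochromaticImmersion H G U) {u : Plane} (hu : u ∈ U)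
    (l k v : Plane) :
    fderiv ℝ (fderiv ℝ (fderiv ℝ G)) u l k v = fderiv ℝ (fderiv ℝ (fderiv ℝ G)) u l v k := by
  have h1 := hG.hasFDerivAt_fderiv_fderiv_apply hu k v
  have h2 : (fun u => fderiv ℝ (fderiv ℝ G) u k v) =ᶠ[𝓝 u]
      fun u => fderiv ℝ (fderiv ℝ G) u v k := by
    filter_upwards [hG.isOpen.mem_nhds hu] with u' hu'
    exact hG.fderiv_fderiv_comm hu' k v
  have h3 := h1.unique ((hG.hasFDerivAt_fderiv_fderiv_apply hu v k).congr_of_eventuallyEq h2)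
  exact DFunLike.congr_fun h3 l

theorem differentiableAt_metric (hG : IsMonochromaticImmersion H G U) (hH : IsSquaredGauge H)
    {u : Plane} (hu : u ∈ U) (v : Plane) :
    DifferentiableAt ℝ (fun u => H (fderiv ℝ G u v)) u := by
  by_cases hv : v = 0
  · subst hv
    simp
  · exact (hG.hasFDerivAt_metric hH hu hv).differentiableAt

theorem fderiv_metric (hG : IsMonochromaticImmersion H G U) (hH : IsSquaredGauge H)
    {u : Plane} (hu : u ∈ U) (k v : Plane) :
    fderiv ℝ (fun u => H (fderiv ℝ G u v)) u k =
      fderiv ℝ H (fderiv ℝ G u v) (fderiv ℝ (fderiv ℝ G) u k v) := by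
  by_cases hv : v = 0
  · subst hv
    simp
  · rw [(hG.hasFDerivAt_metric hH hu hv).fderiv]
    rfl

/-- The second variation of the metric. -/
theorem hasFDerivAt_fderiv_metric (hG : IsMonochromaticImmersion H G U) (hH : IsSquaredGauge H)
    {u : Plane} (hu : u ∈ U) (k : Plane) {v : Plane} (hv : v ≠ 0) :
    HasFDerivAt (fun u' => fderiv ℝ (fun u => H (fderiv ℝ G u v)) u' k)
      ((fderiv ℝ (fderiv ℝ H) (fderiv ℝ G u v) ∘L (fderiv ℝ (fderiv ℝ G) u).flip v).flip
          (fderiv ℝ (fderiv ℝ G) u k v) +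
        fderiv ℝ H (fderiv ℝ G u v) ∘L
          ((fderiv ℝ (fderiv ℝ (fderiv ℝ G)) u).flip k).flip v) u := by
  have h1 : (fun u' => fderiv ℝ (fun u => H (fderiv ℝ G u v)) u' k) =ᶠ[𝓝 u]
      fun u => fderiv ℝ H (fderiv ℝ G u v) (fderiv ℝ (fderiv ℝ G) u k v) := by
    filter_upwards [hG.isOpen.mem_nhds hu] with u' hu'
    exact hG.fderiv_metric hH hu' k v
  refine (((hG.hasFDerivAt_fderiv_gauge hH hu hv).clm_apply
    (hG.hasFDerivAt_fderiv_fderiv_apply hu k v)).congr_of_eventuallyEq h1).congr_fderiv ?_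
  rw [add_comm]

theorem differentiableAt_fderiv_metric (hG : IsMonochromaticImmersion H G U)
    (hH : IsSquaredGauge H) {u : Plane} (hu : u ∈ U) (k v : Plane) :
    DifferentiableAt ℝ (fun u' => fderiv ℝ (fun u => H (fderiv ℝ G u v)) u' k) u := by
  by_cases hv : v = 0
  · subst hv
    simp
  · exact (hG.hasFDerivAt_fderiv_metric hH hu k hv).differentiableAt

theorem fderiv_fderiv_metric (hG : IsMonochromaticImmersion H G U) (hH : IsSquaredGauge H)
    {u : Plane} (hu : u ∈ U) (k l v : Plane) :
    fderiv ℝ (fun u' => fderiv ℝ (fun u => H (fderiv ℝ G u v)) u' k) u l =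
      fderiv ℝ (fderiv ℝ H) (fderiv ℝ G u v) (fderiv ℝ (fderiv ℝ G) u l v)
          (fderiv ℝ (fderiv ℝ G) u k v) +
        fderiv ℝ H (fderiv ℝ G u v) (fderiv ℝ (fderiv ℝ (fderiv ℝ G)) u l k v) := by
  by_cases hv : v = 0
  · subst hv
    simp
  · rw [(hG.hasFDerivAt_fderiv_metric hH hu k hv).fderiv]
    rfl

theorem isQuad (hG : IsMonochromaticImmersion H G U) {u u' : Plane} (hu : u ∈ U) (hu' : u' ∈ U)
    (hq : IsQuad fun v => H (fderiv ℝ G u v)) : IsQuad fun v => H (fderiv ℝ G u' v) := by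
  obtain ⟨L, hL⟩ := hG.equiv u hu u' hu'
  simpa only [hL] using hq.comp L

theorem isQuad_fderiv_metric (hG : IsMonochromaticImmersion H G U) (hH : IsSquaredGauge H)
    {u : Plane} (hu : u ∈ U) (hq : IsQuad fun v => H (fderiv ℝ G u v)) (k : Plane) :
    IsQuad fun v => fderiv ℝ (fun u => H (fderiv ℝ G u v)) u k :=
  isQuad_fderiv (g := fun u v => H (fderiv ℝ G u v))
    ((hG.eventually_mem hu).mono fun _ hu' => hG.isQuad hu hu' hq)
    (hG.differentiableAt_metric hH hu) k

theorem isQuad_fderiv_fderiv_metric (hG : IsMonochromaticImmersion H G U) (hH : IsSquaredGauge H)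
    {u : Plane} (hu : u ∈ U) (hq : IsQuad fun v => H (fderiv ℝ G u v)) (k l : Plane) :
    IsQuad fun v => fderiv ℝ (fun u' => fderiv ℝ (fun u => H (fderiv ℝ G u v)) u' k) u l :=
  isQuad_fderiv (g := fun u' v => fderiv ℝ (fun u => H (fderiv ℝ G u v)) u' k)
    ((hG.eventually_mem hu).mono fun _ hu' =>
      hG.isQuad_fderiv_metric hH hu' (hG.isQuad hu hu' hq) k)
    (hG.differentiableAt_fderiv_metric hH hu k) l

end IsMonochromaticImmersion

section Quadratic

variable {A : Plane →L[ℝ] V} {a b c : ℝ}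

theorem fderiv_eq_polar (hH : IsSquaredGauge H) (hA : ∀ v, v ≠ 0 → A v ≠ 0)
    (hq : (fun v => H (A v)) = quad a b c) {v : Plane} (hv : v ≠ 0) (w : Plane) :
    fderiv ℝ H (A v) (A w) = 2 * polar a b c v w := by
  rw [← fderiv_comp_linear hH hA hv, hq, fderiv_quad]

theorem fderiv_fderiv_eq_polar (hH : IsSquaredGauge H) (hA : ∀ v, v ≠ 0 → A v ≠ 0)
    (hq : (fun v => H (A v)) = quad a b c) {v : Plane} (hv : v ≠ 0) (w w' : Plane) :
    fderiv ℝ (fderiv ℝ H) (A v) (A w) (A w') = 2 * polar a b c w w' := by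
  have h1 := hasFDerivAt_fderiv_comp_linear hH hA hv (A w')
  have h2 : (fun v => fderiv ℝ H (A v) (A w')) =ᶠ[𝓝 v] fun v => fderiv ℝ (quad a b c) w' v := by
    filter_upwards [isOpen_ne.mem_nhds hv] with x hx
    rw [fderiv_eq_polar hH hA hq hx, fderiv_quad, polar_comm]
  have h3 := h1.unique ((fderiv ℝ (quad a b c) w').hasFDerivAt.congr_of_eventuallyEq h2)
  have h4 := DFunLike.congr_fun h3 w
  rw [fderiv_quad, polar_comm] at h4
  exact h4

/-- If `l · dH(n)` is quadratic along a plane on which `H` is quadratic, then `n` can be made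
conjugate to that plane. -/
theorem exists_conjugate (hH : IsSquaredGauge H) (hA : ∀ v, v ≠ 0 → A v ≠ 0)
    (hq : (fun v => H (A v)) = quad a b c) {l : Plane →ₗ[ℝ] ℝ} (hl : l ≠ 0) (n : V)
    (hln : IsQuad fun v => l v * fderiv ℝ H (A v) n) :
    ∃ x, ∀ v, v ≠ 0 → fderiv ℝ H (A v) (n - A x) = 0 := by
  have hpos : ∀ v, v ≠ 0 → 0 < quad a b c v := fun v hv => by
    rw [← hq]; exact hH.pos _ (hA v hv)
  obtain ⟨m, hm⟩ := exists_linear_of_isQuad_mul hl (fun v hv =>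
    (hasFDerivAt_fderiv_comp_linear hH hA hv n).continuousAt) hln
  obtain ⟨x, hx⟩ := exists_polar_eq hpos m
  refine ⟨x, fun v hv => ?_⟩
  rw [map_sub, hm v hv, hx, fderiv_eq_polar hH hA hq hv, sub_self]

end Quadratic

namespace IsMonochromaticImmersion

variable {G : Plane → V} {U : Set Plane} {a b c : ℝ}

/-- The expression of the second variation of a Riemannian metric in terms of a decomposition of
the ambient space into the tangent plane and a conjugate direction. -/
theorem exists_gauss_of_decomp (hG : IsMonochromaticImmersion H G U) (hH : IsSquaredGauge H)
    (hconv : ∀ z, z ≠ 0 → ∀ w, w ≠ 0 → 0 < fderiv ℝ (fderiv ℝ H) z w w)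
    {u : Plane} (hu : u ∈ U) (hq : (fun v => H (fderiv ℝ G u v)) = quad a b c)
    {π : V →L[ℝ] Plane} {ν : V →L[ℝ] ℝ} {N : V} (hN0 : N ≠ 0)
    (hz : ∀ z, z = fderiv ℝ G u (π z) + ν z • N)
    (hN : (∀ v, v ≠ 0 → fderiv ℝ H (fderiv ℝ G u v) N = 0) ∨
      ∀ k v, ν (fderiv ℝ (fderiv ℝ G) u k v) = 0 ∧
        ∀ l, ν (fderiv ℝ (fderiv ℝ (fderiv ℝ G)) u l k v) = 0) :
    ∃ γ : ℝ, 0 < γ ∧ ∀ k v, v ≠ 0 →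
      fderiv ℝ (fun u => H (fderiv ℝ G u v)) u k =
          2 * polar a b c v (π (fderiv ℝ (fderiv ℝ G) u k v)) ∧
      ∀ l, fderiv ℝ (fun u' => fderiv ℝ (fun u => H (fderiv ℝ G u v)) u' k) u l =
        2 * polar a b c (π (fderiv ℝ (fderiv ℝ G) u l v)) (π (fderiv ℝ (fderiv ℝ G) u k v)) +
        ν (fderiv ℝ (fderiv ℝ G) u l v) * ν (fderiv ℝ (fderiv ℝ G) u k v) * γ +
        2 * polar a b c v (π (fderiv ℝ (fderiv ℝ (fderiv ℝ G)) u l k v)) := by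
  have hq' := hG.isQuad_fderiv_fderiv_metric hH hu ⟨a, b, c, hq⟩
  simp only [hG.fderiv_fderiv_metric hH hu, hG.fderiv_metric hH hu] at hq' ⊢
  set A := fderiv ℝ G u with hA
  set Q := fderiv ℝ (fderiv ℝ G) u with hQ
  set T := fderiv ℝ (fderiv ℝ (fderiv ℝ G)) u with hT
  have hAi : ∀ v, v ≠ 0 → A v ≠ 0 := hG.injective u hu
  rcases hN with hN | hN
  · have hsymm : ∀ v, v ≠ 0 → ∀ z z', fderiv ℝ (fderiv ℝ H) (A v) z z' =
        fderiv ℝ (fderiv ℝ H) (A v) z' z := fun v hv z z' =>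
      (hH.contDiffAt _ (hAi v hv)).isSymmSndFDerivAt minSmoothness_two_le z z'
    set f : Plane → ℝ := fun v => fderiv ℝ (fderiv ℝ H) (A v) N N with hf
    have hfpos : ∀ v, v ≠ 0 → 0 < f v := fun v hv => hconv _ (hAi v hv) _ hN0
    have hfc : ∀ v, v ≠ 0 → ContinuousAt f v := by
      intro v hv
      have h1 : ContinuousAt (fun v => fderiv ℝ (fderiv ℝ H) (A v)) v :=
        ContinuousAt.comp (g := fderiv ℝ (fderiv ℝ H)) (f := A)
          (hH.continuousAt_fderiv_fderiv (hAi v hv)) A.continuous.continuousAt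
      exact (h1.clm_apply continuousAt_const).clm_apply continuousAt_const
    have h1 : ∀ v, v ≠ 0 → ∀ z, fderiv ℝ H (A v) z = 2 * polar a b c v (π z) := by
      intro v hv z
      conv_lhs => rw [hz z]
      rw [map_add, map_smul, hN v hv, smul_zero, add_zero, fderiv_eq_polar hH hAi hq hv]
    have h2 : ∀ v, v ≠ 0 → ∀ z z', fderiv ℝ (fderiv ℝ H) (A v) z z' =
        2 * polar a b c (π z) (π z') + ν z * ν z' * f v := by
      intro v hv z z'
      conv_lhs => rw [hz z, hz z']
      simp only [map_add, map_smul, add_apply, smul_apply, smul_eq_mul,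
        fderiv_fderiv_eq_polar hH hAi hq hv, sndFDeriv_eq_zero hH hAi hN hv,
        hsymm v hv N (A _), hf]
      ring
    -- Every other term of the second variation along `l`, and the variation itself, is quadratic in
    -- `v`.
    have h3 : ∀ l, IsQuad fun v => ν (Q l v) * ν (Q l v) * f v := by
      intro l
      have e1 := isQuad_polar a b c (π ∘L Q l).toLinearMap (π ∘L Q l).toLinearMap
      have e2 := isQuad_polar a b c LinearMap.id (π ∘L T l l).toLinearMap
      have e3 := ((hq' l l).sub (e1.const_mul 2)).sub (e2.const_mul 2)
      convert e3 using 2 with v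
      by_cases hv : v = 0
      · subst hv
        simp [polar]
      · rw [h1 v hv, h2 v hv]
        simp only [ContinuousLinearMap.coe_coe, ContinuousLinearMap.comp_apply, LinearMap.id_apply]
        ring
    -- If some form `ν ∘ Q l` is nonzero, the quadraticity in `h3` and the positivity of `f` make
    -- `f` constant; otherwise the products vanish and any `γ` serves.
    obtain ⟨γ, hγ, hγ'⟩ : ∃ γ : ℝ, 0 < γ ∧ ∀ k l v, v ≠ 0 →
        ν (Q l v) * ν (Q k v) * f v = ν (Q l v) * ν (Q k v) * γ := by
      by_cases hl : ∃ l, (ν ∘L Q l).toLinearMap ≠ 0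
      · obtain ⟨l, hl⟩ := hl
        obtain ⟨γ, hγ, h4⟩ := exists_const_of_isQuad_sq_mul hl hfc hfpos (h3 l)
        exact ⟨γ, hγ, fun k l v hv => by rw [h4 v hv]⟩
      · push Not at hl
        refine ⟨1, one_pos, fun k l v hv => ?_⟩
        have : ν (Q l v) = 0 := LinearMap.congr_fun (hl l) v
        simp [this]
    refine ⟨γ, hγ, fun k v hv => ⟨h1 v hv _, fun l => ?_⟩⟩
    rw [h1 v hv, h2 v hv, hγ' k l v hv]
  · refine ⟨1, one_pos, fun k v hv => ?_⟩
    have h1 : ∀ z, ν z = 0 → z = A (π z) := fun z h0 => by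
      conv_lhs => rw [hz z, h0, zero_smul, add_zero]
    have h2 : ∀ k, Q k v = A (π (Q k v)) := fun k => h1 _ (hN k v).1
    constructor
    · conv_lhs => rw [h2 k]
      rw [fderiv_eq_polar hH hAi hq hv]
    · intro l
      conv_lhs => rw [h2 k, h2 l, h1 _ ((hN k v).2 l)]
      rw [fderiv_eq_polar hH hAi hq hv, fderiv_fderiv_eq_polar hH hAi hq hv, (hN k v).1]
      ring

/-- The Gauss equation: for a Riemannian metric induced by a monochromatic immersion, the
determinant of the second fundamental form has the sign of an intrinsic quantity. -/
theorem exists_gauss (hG : IsMonochromaticImmersion H G U) (hH : IsSquaredGauge H)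
    (hconv : ∀ z, z ≠ 0 → ∀ w, w ≠ 0 → 0 < fderiv ℝ (fderiv ℝ H) z w w)
    {u : Plane} (hu : u ∈ U) (hq : (fun v => H (fderiv ℝ G u v)) = quad a b c)
    {n : V} (hI : (frame (fderiv ℝ G u) n).IsInvertible) :
    ∃ (γ : ℝ) (Γ : Plane →L[ℝ] Plane →L[ℝ] Plane), 0 < γ ∧ (∀ v w, Γ v w = Γ w v) ∧
      (∀ k v, fderiv ℝ (fun u => H (fderiv ℝ G u v)) u k = 2 * polar a b c v (Γ k v)) ∧
      curvatureTerm (fun u v => H (fderiv ℝ G u v)) u =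
        2 * polar a b c (Γ e₀ e₁) (Γ e₀ e₁) - 2 * polar a b c (Γ e₀ e₀) (Γ e₁ e₁) -
        γ * formDet (normalForm (fderiv ℝ G u) n (fderiv ℝ (fderiv ℝ G) u)) := by
  set A := fderiv ℝ G u with hA
  set Q := fderiv ℝ (fderiv ℝ G) u with hQ
  set T := fderiv ℝ (fderiv ℝ (fderiv ℝ G)) u with hT
  have hAi : ∀ v, v ≠ 0 → A v ≠ 0 := hG.injective u hu
  have hq0 : IsQuad fun v => H (A v) := ⟨a, b, c, hq⟩
  -- If the second fundamental form is nonzero, the first variation shows that a nonzero linear form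
  -- times `dH(Av) n` is quadratic, and `exists_conjugate` applies. If it vanishes, a nonzero normal
  -- part of the third derivative does the same through the second variation. If both vanish, no
  -- conjugate direction is needed.
  obtain ⟨x, hx⟩ : ∃ x, (∀ v, v ≠ 0 → fderiv ℝ H (A v) (n - A x) = 0) ∨
      ∀ k v, normalPart A n (Q k v) = 0 ∧ ∀ l, normalPart A n (T l k v) = 0 := by
    by_cases h1 : ∃ k, (normalPart A n ∘L Q k).toLinearMap ≠ 0
    · obtain ⟨k, hk⟩ := h1
      obtain ⟨x, hx⟩ := exists_conjugate hH hAi hq hk n (by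
        have e1 := hG.isQuad_fderiv_metric hH hu hq0 k
        have e2 := isQuad_polar a b c LinearMap.id (tangentPart A n ∘L Q k).toLinearMap
        convert e1.sub (e2.const_mul 2) using 2 with v
        rw [hG.fderiv_metric hH hu, ← hQ, ← hA]
        by_cases hv : v = 0
        · subst hv
          simp [polar]
        · conv_rhs => rw [frame_decomp hI (Q k v)]
          rw [map_add, map_smul, fderiv_eq_polar hH hAi hq hv]
          simp)
      exact ⟨x, Or.inl hx⟩
    push Not at h1
    replace h1 : ∀ k v, normalPart A n (Q k v) = 0 := fun k v => LinearMap.congr_fun (h1 k) v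
    have hQA : ∀ k v, Q k v = A (tangentPart A n (Q k v)) := fun k v => by
      conv_lhs => rw [frame_decomp hI (Q k v), h1, zero_smul, add_zero]
    by_cases h2 : ∃ l k, (normalPart A n ∘L T l k).toLinearMap ≠ 0
    · obtain ⟨l, k, hk⟩ := h2
      obtain ⟨x, hx⟩ := exists_conjugate hH hAi hq hk n (by
        have e1 := hG.isQuad_fderiv_fderiv_metric hH hu hq0 k l
        have e2 := isQuad_polar a b c LinearMap.id (tangentPart A n ∘L T l k).toLinearMap
        have e3 := isQuad_polar a b c (tangentPart A n ∘L Q l).toLinearMap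
          (tangentPart A n ∘L Q k).toLinearMap
        convert (e1.sub (e2.const_mul 2)).sub (e3.const_mul 2) using 2 with v
        rw [hG.fderiv_fderiv_metric hH hu, ← hQ, ← hA, ← hT]
        by_cases hv : v = 0
        · subst hv
          simp [polar]
        · conv_rhs => rw [frame_decomp hI (T l k v), hQA l v, hQA k v]
          rw [map_add, map_smul, fderiv_eq_polar hH hAi hq hv,
            fderiv_fderiv_eq_polar hH hAi hq hv]
          simp only [ContinuousLinearMap.coe_coe, ContinuousLinearMap.comp_apply,
            LinearMap.id_apply, smul_eq_mul]
          ring)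
      exact ⟨x, Or.inl hx⟩
    · push Not at h2
      exact ⟨0, Or.inr fun k v => ⟨h1 k v, fun l => LinearMap.congr_fun (h2 l k) v⟩⟩
  -- Replacing `n` by `n - A x` changes the tangential component but not the normal one.
  set π : V →L[ℝ] Plane := tangentPart A n + (normalPart A n).smulRight x with hπ
  set ν := normalPart A n with hν
  have hz : ∀ z, z = A (π z) + ν z • (n - A x) := by
    intro z
    conv_lhs => rw [frame_decomp hI z]
    simp only [hπ, add_apply, ContinuousLinearMap.smulRight_apply, map_add, map_smul]
    module
  obtain ⟨γ, hγ, hγ'⟩ := hG.exists_gauss_of_decomp hH hconv hu hq (frame_ne_zero hI x) hz hx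
  have hQs : ∀ k v, Q k v = Q v k := hG.fderiv_fderiv_comm hu
  have hTs : ∀ l k v, T l k v = T k l v := hG.fderiv_fderiv_fderiv_comm hu
  have hTs' : ∀ l k v, T l k v = T l v k := hG.fderiv_fderiv_fderiv_comm' hu
  refine ⟨γ, ContinuousLinearMap.compL ℝ Plane V Plane π ∘L Q, hγ, fun v w => ?_,
    fun k v => ?_, ?_⟩
  · simp [hQs v w]
  · by_cases hv : v = 0
    · subst hv
      simp [polar]
    · exact (hγ' k v hv).1
  · have h01 : e₀ + e₁ ≠ 0 := ne_zero_iff.2 (by simp)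
    simp only [curvatureTerm]
    rw [(hγ' e₁ e₀ e₀_ne_zero).2, (hγ' e₀ e₁ e₁_ne_zero).2, (hγ' e₀ _ h01).2,
      (hγ' e₀ e₀ e₀_ne_zero).2, (hγ' e₀ e₁ e₁_ne_zero).2]
    simp only [ContinuousLinearMap.comp_apply, ContinuousLinearMap.compL_apply, formDet,
      normalForm_apply, map_add, polar_add, add_polar, ← hQ, ← hT, ← hν]
    -- By symmetry of the third derivative of `G`, its terms cancel.
    rw [hTs' e₁ e₁ e₀, hTs e₁ e₀ e₁, hTs e₁ e₀ e₀, hTs' e₀ e₁ e₀, hQs e₁ e₀,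
      hTs' e₀ e₁ e₁]
    rw [polar_comm a b c (π (Q e₁ e₁)) (π (Q e₀ e₀))]
    ring

/-- Theorema egregium for two monochromatic immersions inducing the same Riemannian metric. -/
theorem formDet_eq {W : Type*} [NormedAddCommGroup W] [NormedSpace ℝ W] {K : W → ℝ}
    {F : Plane → W} (hG : IsMonochromaticImmersion H G U) (hH : IsSquaredGauge H)
    (hconv : ∀ z, z ≠ 0 → ∀ w, w ≠ 0 → 0 < fderiv ℝ (fderiv ℝ H) z w w)
    (hF : IsMonochromaticImmersion K F U) (hK : IsSquaredGauge K)
    (hconv' : ∀ z, z ≠ 0 → ∀ w, w ≠ 0 → 0 < fderiv ℝ (fderiv ℝ K) z w w)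
    (hGF : ∀ u ∈ U, ∀ v, H (fderiv ℝ G u v) = K (fderiv ℝ F u v))
    {u : Plane} (hu : u ∈ U) (hq : IsQuad fun v => H (fderiv ℝ G u v))
    {n : V} (hI : (frame (fderiv ℝ G u) n).IsInvertible)
    {n' : W} (hI' : (frame (fderiv ℝ F u) n').IsInvertible) :
    ∃ γ γ' : ℝ, 0 < γ ∧ 0 < γ' ∧
      γ * formDet (normalForm (fderiv ℝ G u) n (fderiv ℝ (fderiv ℝ G) u)) =
      γ' * formDet (normalForm (fderiv ℝ F u) n' (fderiv ℝ (fderiv ℝ F) u)) := by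
  obtain ⟨a, b, c, hq⟩ := hq
  have hq' : (fun v => K (fderiv ℝ F u v)) = quad a b c := by
    rw [← hq]
    ext v
    exact (hGF u hu v).symm
  obtain ⟨γ, Γ, hγ, hΓ, hΓ1, hc⟩ := hG.exists_gauss hH hconv hu hq hI
  obtain ⟨γ', Γ', hγ', hΓ', hΓ1', hc'⟩ := hF.exists_gauss hK hconv' hu hq' hI'
  have hev : (fun u v => H (fderiv ℝ G u v)) =ᶠ[𝓝 u] fun u v => K (fderiv ℝ F u v) := by
    filter_upwards [hG.isOpen.mem_nhds hu] with u' hu'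
    ext v
    exact hGF u' hu' v
  -- The connection terms are intrinsic, so the two Gauss equations differ only in their determinant
  -- terms.
  have hΓΓ : ∀ v w, Γ v w = Γ' v w := by
    refine eq_of_polar_eq (a := a) (b := b) (c := c) (fun v hv => ?_) hΓ hΓ' fun k v => ?_
    · rw [← hq]
      exact hH.pos _ (hG.injective u hu v hv)
    · have h1 : (fun u => H (fderiv ℝ G u v)) =ᶠ[𝓝 u] fun u => K (fderiv ℝ F u v) :=
        hev.mono fun u' hu' => congrFun hu' v
      have h2 := hΓ1 k v
      rw [h1.fderiv_eq, hΓ1'] at h2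
      linarith
  refine ⟨γ, γ', hγ, hγ', ?_⟩
  rw [hev.curvatureTerm_eq, hc'] at hc
  simp only [hΓΓ] at hc
  linarith

end IsMonochromaticImmersion

end GaussEquation

/-! ### The type of a form from the sign of its determinant -/

section FormTypes

variable {L : Type*} [NormedAddCommGroup L] [NormedSpace ℝ L] {B : Plane →L[ℝ] Plane →L[ℝ] L}
  {b : Plane →L[ℝ] Plane →L[ℝ] ℝ} {e : L ≃ₗ[ℝ] ℝ}

theorem bilin_apply_self (b : Plane →L[ℝ] Plane →L[ℝ] ℝ) (hs : b e₁ e₀ = b e₀ e₁) (v : Plane) :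
    b v v = b e₀ e₀ * v 0 ^ 2 + 2 * b e₀ e₁ * (v 0 * v 1) + b e₁ e₁ * v 1 ^ 2 := by
  conv_lhs => rw [eq_comb v]
  simp only [map_add, map_smul, add_apply, smul_apply, smul_eq_mul, hs]
  ring

theorem isDefiniteForm_of_formDet_pos (he : ∀ v w, e (B v w) = b v w)
    (hs : b e₁ e₀ = b e₀ e₁) (hb : 0 < formDet b) : IsDefiniteForm B := by
  simp only [formDet, hs] at hb
  have h0 : b e₀ e₀ ≠ 0 := by
    intro h0
    rw [h0] at hb
    nlinarith [sq_nonneg (b e₀ e₁)]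
  -- Rescaling by `b e₀ e₀` makes the form positive whatever its original sign; the rest is
  -- completing the square.
  refine ⟨e.trans (LinearEquiv.smulOfNeZero ℝ ℝ (b e₀ e₀) h0), fun v hv => ?_⟩
  simp only [LinearEquiv.trans_apply, LinearEquiv.smulOfNeZero_apply, he, smul_eq_mul]
  rw [bilin_apply_self b hs v]
  have h1 : b e₀ e₀ * (b e₀ e₀ * v 0 ^ 2 + 2 * b e₀ e₁ * (v 0 * v 1) + b e₁ e₁ * v 1 ^ 2) =
      (b e₀ e₀ * v 0 + b e₀ e₁ * v 1) ^ 2 +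
        (b e₀ e₀ * b e₁ e₁ - b e₀ e₁ * b e₀ e₁) * v 1 ^ 2 := by ring
  rw [h1]
  by_cases h2 : v 1 = 0
  · have h3 : v 0 ≠ 0 := (ne_zero_iff.1 hv).resolve_right (not_not.2 h2)
    rw [h2]
    have : b e₀ e₀ * v 0 ≠ 0 := mul_ne_zero h0 h3
    have := pow_pos (abs_pos.2 this) 2
    rw [sq_abs] at this
    simpa using this
  · have := mul_pos hb (pow_pos (abs_pos.2 h2) 2)
    rw [sq_abs] at this
    nlinarith [sq_nonneg (b e₀ e₀ * v 0 + b e₀ e₁ * v 1)]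

theorem isDegenerateForm_of_formDet_eq_zero (he : ∀ v w, e (B v w) = b v w)
    (hs : b e₁ e₀ = b e₀ e₁) (hb : formDet b = 0) : IsDegenerateForm B := by
  obtain ⟨v, hv, h0, h1⟩ : ∃ v, v ≠ 0 ∧ b v e₀ = 0 ∧ b v e₁ = 0 := by
    simp only [formDet] at hb
    by_cases h : b e₀ e₀ = 0 ∧ b e₀ e₁ = 0
    · exact ⟨e₀, e₀_ne_zero, h.1, h.2⟩
    · refine ⟨b e₀ e₁ • e₀ - b e₀ e₀ • e₁, ne_zero_iff.2 ?_, ?_, ?_⟩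
      · by_contra! h1
        simp at h1
        exact h ⟨h1.2, h1.1⟩
      · simp [hs]
        ring
      · rw [hs] at hb
        simp
        linarith
  refine ⟨v, hv, fun w => ?_⟩
  rw [← e.map_eq_zero_iff, he, eq_comb w, map_add, map_smul, map_smul, h0, h1]
  simp

theorem isIndefiniteForm_of_formDet_neg (he : ∀ v w, e (B v w) = b v w)
    (hs : b e₁ e₀ = b e₀ e₁) (hb : formDet b < 0) : IsIndefiniteForm B := by
  constructor
  · rintro ⟨v, hv, h0⟩
    have h1 : ∀ w, b v w = 0 := fun w => by rw [← he, h0, map_zero]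
    have h2 : ∀ w, b w v = b v w := by
      intro w
      rw [eq_comb v, eq_comb w]
      simp only [map_add, map_smul, add_apply, smul_apply, smul_eq_mul, hs]
      ring
    rcases exists_ne_zero_of_formDet hb.ne hv with h | h <;> exact h (by rw [h2, h1])
  · refine ⟨e, ?_⟩
    simp only [he]
    suffices h : (∃ v : Plane,
        0 < b e₀ e₀ * v 0 ^ 2 + 2 * b e₀ e₁ * (v 0 * v 1) + b e₁ e₁ * v 1 ^ 2) ∧ ∃ v : Plane,
        b e₀ e₀ * v 0 ^ 2 + 2 * b e₀ e₁ * (v 0 * v 1) + b e₁ e₁ * v 1 ^ 2 < 0 by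
      obtain ⟨⟨v, hv⟩, w, hw⟩ := h
      exact ⟨⟨v, by rwa [bilin_apply_self b hs v]⟩, w, by rwa [bilin_apply_self b hs w]⟩
    simp only [formDet, hs] at hb
    have h1 : ∀ x y : ℝ, ∃ v : Plane, v 0 = x ∧ v 1 = y := fun x y => ⟨!₂[x, y], rfl, rfl⟩
    -- At this vector, `b`-orthogonal to `e₀`, the form takes the value `b e₀ e₀ * formDet b`,
    -- opposite in sign to `b e₀ e₀`.
    obtain ⟨v, hv0, hv1⟩ := h1 (-b e₀ e₁) (b e₀ e₀)
    have h2 : b e₀ e₀ * v 0 ^ 2 + 2 * b e₀ e₁ * (v 0 * v 1) + b e₁ e₁ * v 1 ^ 2 =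
        b e₀ e₀ * (b e₀ e₀ * b e₁ e₁ - b e₀ e₁ * b e₀ e₁) := by
      rw [hv0, hv1]; ring
    rcases lt_trichotomy (b e₀ e₀) 0 with h | h | h
    · refine ⟨⟨v, ?_⟩, e₀, by simpa using h⟩
      rw [h2]
      exact mul_pos_of_neg_of_neg h hb
    · have hq : b e₀ e₁ ≠ 0 := by
        intro h0
        simp [h, h0] at hb
      -- When `b e₀ e₀ = 0` the form is affine on the line `v 1 = 1`; `w` and `z` are the points
      -- with values `1` and `-1`.
      obtain ⟨w, hw0, hw1⟩ := h1 ((1 - b e₁ e₁) / (2 * b e₀ e₁)) 1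
      obtain ⟨z, hz0, hz1⟩ := h1 ((-1 - b e₁ e₁) / (2 * b e₀ e₁)) 1
      refine ⟨⟨w, ?_⟩, z, ?_⟩
      · have h3 : 2 * b e₀ e₁ * (w 0 * w 1) = 1 - b e₁ e₁ := by
          rw [hw0, hw1]
          field_simp
        rw [h3, hw1, h]
        linarith
      · have h3 : 2 * b e₀ e₁ * (z 0 * z 1) = -1 - b e₁ e₁ := by
          rw [hz0, hz1]
          field_simp
        rw [h3, hz1, h]
        linarith
    · refine ⟨⟨e₀, by simpa using h⟩, v, ?_⟩
      rw [h2]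
      exact mul_neg_of_pos_of_neg h hb

end FormTypes

/-! ### Passage to the chart -/

section Chart

variable {M : Type*} [TopologicalSpace M] [ChartedSpace (EuclideanSpace ℝ (Fin 2)) M]
  [IsManifold (𝓡 2) ∞ M] {V : Type*} [NormedAddCommGroup V] [NormedSpace ℝ V]

theorem isInvertible_mfderiv_extChartAt_symm (p : M) {u : Plane}
    (hu : u ∈ (extChartAt (𝓡 2) p).target) :
    (mfderiv 𝓘(ℝ, Plane) (𝓡 2) (extChartAt (𝓡 2) p).symm u).IsInvertible := by
  have : IsManifold (𝓡 2) 1 M := IsManifold.of_le (n := ∞) (by simp)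
  have h1 := isInvertible_mfderivWithin_extChartAt_symm hu
  rwa [ModelWithCorners.range_eq_univ, mfderivWithin_univ] at h1

theorem fderiv_comp_extChartAt_symm {f : M → V} (hf : ContMDiff (𝓡 2) 𝓘(ℝ, V) ∞ f) (p : M)
    {u : Plane} (hu : u ∈ (extChartAt (𝓡 2) p).target) (v : Plane) :
    fderiv ℝ (f ∘ (extChartAt (𝓡 2) p).symm) u v =
      mfderiv (𝓡 2) 𝓘(ℝ, V) f ((extChartAt (𝓡 2) p).symm u)
        (mfderiv 𝓘(ℝ, Plane) (𝓡 2) (extChartAt (𝓡 2) p).symm u v) := by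
  have h1 : MDifferentiableAt 𝓘(ℝ, Plane) (𝓡 2) (extChartAt (𝓡 2) p).symm u :=
    ((contMDiffOn_extChartAt_symm (n := ∞) p).contMDiffAt
      ((isOpen_extChartAt_target p).mem_nhds hu)).mdifferentiableAt (by simp)
  rw [← mfderiv_eq_fderiv, mfderiv_comp u ((hf _).mdifferentiableAt (by simp)) h1]
  rfl

theorem contDiffAt_comp_extChartAt_symm {f : M → V} (hf : ContMDiff (𝓡 2) 𝓘(ℝ, V) ∞ f) (p : M)
    {u : Plane} (hu : u ∈ (extChartAt (𝓡 2) p).target) :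
    ContDiffAt ℝ ∞ (f ∘ (extChartAt (𝓡 2) p).symm) u := by
  have h1 : ContMDiffAt 𝓘(ℝ, Plane) (𝓡 2) ∞ (extChartAt (𝓡 2) p).symm u :=
    (contMDiffOn_extChartAt_symm (n := ∞) p).contMDiffAt
      ((isOpen_extChartAt_target p).mem_nhds hu)
  exact ((hf _).comp u h1).contDiffAt

namespace FinslerMetric

variable (φ : FinslerMetric 2 M)

/-- The expression of a Finsler metric in the preferred chart at `p`. -/
def inChart (p : M) (u v : Plane) : ℝ :=
  φ.toFun ((extChartAt (𝓡 2) p).symm u)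
    (mfderiv 𝓘(ℝ, Plane) (𝓡 2) (extChartAt (𝓡 2) p).symm u v)

variable {φ} {Φ : V → ℝ} {f : M → V}

namespace IsSmoothIsometricEmbedding

theorem norm_fderiv (hf : φ.IsSmoothIsometricEmbedding Φ f) (p : M) {u : Plane}
    (hu : u ∈ (extChartAt (𝓡 2) p).target) (v : Plane) :
    Φ (fderiv ℝ (f ∘ (extChartAt (𝓡 2) p).symm) u v) = φ.inChart p u v := by
  rw [fderiv_comp_extChartAt_symm hf.isSmoothEmbedding.contMDiff p hu]
  exact hf.norm_preserving _ _

theorem isMonochromaticImmersion (hf : φ.IsSmoothIsometricEmbedding Φ f)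
    (hΦ : IsBanachMinkowskiNorm Φ) (hφ : φ.IsMonochromatic) (p : M) :
    IsMonochromaticImmersion (fun v => Φ v ^ 2) (f ∘ (extChartAt (𝓡 2) p).symm)
      (extChartAt (𝓡 2) p).target where
  isOpen := isOpen_extChartAt_target p
  contDiffAt u hu := contDiffAt_comp_extChartAt_symm hf.isSmoothEmbedding.contMDiff p hu
  injective u hu v hv h0 := by
    have h1 := hf.norm_fderiv p hu v
    rw [h0, (hΦ.eq_zero_iff 0).2 rfl] at h1
    have h2 := ((φ.isBanachMinkowskiNorm _).eq_zero_iff _).1 h1.symm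
    exact hv ((isInvertible_mfderiv_extChartAt_symm p hu).injective (h2.trans (map_zero _).symm))
  equiv u hu u' hu' := by
    obtain ⟨L, hL⟩ := hφ ((extChartAt (𝓡 2) p).symm u') ((extChartAt (𝓡 2) p).symm u)
    -- The monochromatic isomorphism, transported to the plane by the differentials of the inverse
    -- chart.
    refine ⟨(mfderiv 𝓘(ℝ, Plane) (𝓡 2) (extChartAt (𝓡 2) p).symm u).inverse.toLinearMap ∘ₗ
      L.toLinearMap ∘ₗ
      (mfderiv 𝓘(ℝ, Plane) (𝓡 2) (extChartAt (𝓡 2) p).symm u').toLinearMap, fun v => ?_⟩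
    have h1 := hf.norm_fderiv p hu' v
    rw [inChart, ← hL] at h1
    simp only [h1]
    rw [hf.norm_fderiv p hu, inChart]
    congr 2
    exact ((isInvertible_mfderiv_extChartAt_symm p hu).self_apply_inverse _).symm

end IsSmoothIsometricEmbedding

end FinslerMetric

/-- The differential of the inverse chart is onto, so composing with it does not change the image.
-/
theorem tangentImage_eq_range {f : M → V} (hf : ContMDiff (𝓡 2) 𝓘(ℝ, V) ∞ f) (p : M) :
    (tangentImage 2 f p : Set V) =
      Set.range (fderiv ℝ (f ∘ (extChartAt (𝓡 2) p).symm) (extChartAt (𝓡 2) p p)) := by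
  have hp : extChartAt (𝓡 2) p p ∈ (extChartAt (𝓡 2) p).target := mem_extChartAt_target p
  have hs := (isInvertible_mfderiv_extChartAt_symm p hp).surjective
  have hpp : (extChartAt (𝓡 2) p).symm (extChartAt (𝓡 2) p p) = p := extChartAt_to_inv p
  have h0 : (tangentImage 2 f p : Set V) = tangentImage 2 f
      ((extChartAt (𝓡 2) p).symm (extChartAt (𝓡 2) p p)) := by rw [hpp]
  rw [h0]
  ext z
  constructor
  · rintro ⟨w, rfl⟩
    obtain ⟨v, rfl⟩ := hs w
    exact ⟨v, fderiv_comp_extChartAt_symm hf p hp v⟩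
  · rintro ⟨v, rfl⟩
    exact ⟨_, (fderiv_comp_extChartAt_symm hf p hp v).symm⟩

variable [FiniteDimensional ℝ V]

theorem exists_frame_isInvertible (hV : Module.finrank ℝ V = 3) {A : Plane →L[ℝ] V}
    (hA : ∀ v, v ≠ 0 → A v ≠ 0) : ∃ n, (frame A n).IsInvertible := by
  have hinj : Function.Injective A := by
    rw [injective_iff_map_eq_zero]
    intro v hv
    by_contra h0
    exact hA v h0 hv
  have hlt : A.range < ⊤ := by
    refine lt_of_le_of_ne le_top fun h => ?_
    have h1 := LinearMap.finrank_range_le A.toLinearMap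
    have h2 : Module.finrank ℝ A.range = 3 := by rw [h, finrank_top, hV]
    rw [h2] at h1
    simp at h1
  obtain ⟨n, -, hn⟩ := SetLike.exists_of_lt hlt
  refine ⟨n, ?_⟩
  have hinj' : Function.Injective (frame A n) := by
    rw [injective_iff_map_eq_zero]
    rintro ⟨w, t⟩ h
    rw [frame_apply] at h
    have ht : t = 0 := by
      by_contra ht
      refine hn ⟨-(t⁻¹ • w), ?_⟩
      have h1 : A w = -(t • n) := eq_neg_of_add_eq_zero_left h
      change A (-(t⁻¹ • w)) = n
      rw [map_neg, map_smul, h1, smul_neg, neg_neg, smul_smul, inv_mul_cancel₀ ht, one_smul]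
    subst ht
    rw [zero_smul, add_zero] at h
    rw [hinj (h.trans (map_zero A).symm)]
    rfl
  have hdim : Module.finrank ℝ (Plane × ℝ) = Module.finrank ℝ V := by
    rw [hV]
    simp
  exact ⟨(LinearEquiv.ofInjectiveOfFinrankEq (frame A n).toLinearMap hinj'
    hdim).toContinuousLinearEquiv, rfl⟩

theorem secondFundamentalForm_apply {f : M → V} (hf : ContMDiff (𝓡 2) 𝓘(ℝ, V) ∞ f) (p : M)
    (v w : Plane) : secondFundamentalForm 2 f p v w = (tangentImage 2 f p).mkQ
      (fderiv ℝ (fderiv ℝ (f ∘ (extChartAt (𝓡 2) p).symm)) (extChartAt (𝓡 2) p p) v w) := by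
  set G := f ∘ (extChartAt (𝓡 2) p).symm with hG
  set π : V →L[ℝ] V ⧸ tangentImage 2 f p := (tangentImage 2 f p).mkQL with hπ
  have hp : extChartAt (𝓡 2) p p ∈ (extChartAt (𝓡 2) p).target := mem_extChartAt_target p
  have h1 : fderiv ℝ (π ∘ G) =ᶠ[𝓝 (extChartAt (𝓡 2) p p)] fun u => π ∘L fderiv ℝ G u := by
    filter_upwards [(isOpen_extChartAt_target p).mem_nhds hp] with u hu
    exact (π.hasFDerivAt.comp u ((contDiffAt_comp_extChartAt_symm hf p hu).differentiableAt
      (by simp)).hasFDerivAt).fderiv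
  have h2 : DifferentiableAt ℝ (fderiv ℝ G) (extChartAt (𝓡 2) p p) :=
    ((contDiffAt_comp_extChartAt_symm hf p hp).fderiv_right (m := ∞) (by simp)).differentiableAt
      (by simp)
  have h3 : fderiv ℝ (fun u => π ∘L fderiv ℝ G u) (extChartAt (𝓡 2) p p) =
      ContinuousLinearMap.compL ℝ Plane V (V ⧸ tangentImage 2 f p) π ∘L
        fderiv ℝ (fderiv ℝ G) (extChartAt (𝓡 2) p p) :=
    ((ContinuousLinearMap.compL ℝ Plane V (V ⧸ tangentImage 2 f p) π).hasFDerivAt.comp _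
      h2.hasFDerivAt).fderiv
  change fderiv ℝ (fderiv ℝ (π ∘ G)) (extChartAt (𝓡 2) p p) v w = _
  rw [h1.fderiv_eq, h3]
  rfl

/-- In a frame, the second fundamental form is the normal component of the second derivative. -/
theorem exists_secondFundamentalForm_eq {f : M → V} (hf : ContMDiff (𝓡 2) 𝓘(ℝ, V) ∞ f) (p : M)
    {n : V} (hI : (frame (fderiv ℝ (f ∘ (extChartAt (𝓡 2) p).symm) (extChartAt (𝓡 2) p p))
      n).IsInvertible) :
    ∃ e : (V ⧸ tangentImage 2 f p) ≃ₗ[ℝ] ℝ, ∀ v w : Plane,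
      e (secondFundamentalForm 2 f p v w) =
        normalForm (fderiv ℝ (f ∘ (extChartAt (𝓡 2) p).symm) (extChartAt (𝓡 2) p p)) n
          (fderiv ℝ (fderiv ℝ (f ∘ (extChartAt (𝓡 2) p).symm)) (extChartAt (𝓡 2) p p)) v w := by
  set A := fderiv ℝ (f ∘ (extChartAt (𝓡 2) p).symm) (extChartAt (𝓡 2) p p) with hA
  -- The normal component has the tangent plane as kernel, so it identifies the quotient line with
  -- `ℝ`.
  have hker : tangentImage 2 f p = LinearMap.ker (normalPart A n).toLinearMap := by
    apply SetLike.coe_injective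
    rw [tangentImage_eq_range hf p, ← hA]
    ext z
    constructor
    · rintro ⟨w, rfl⟩
      simpa using normalPart_apply hI w 0
    · intro hz
      refine ⟨tangentPart A n z, ?_⟩
      have hz' : normalPart A n z = 0 := hz
      conv_rhs => rw [frame_decomp hI z, hz', zero_smul, add_zero]
  have hsurj : Function.Surjective (normalPart A n).toLinearMap := fun t =>
    ⟨t • n, by simpa using normalPart_apply hI 0 t⟩
  refine ⟨(Submodule.quotEquivOfEq _ _ hker).trans
    ((normalPart A n).toLinearMap.quotKerEquivOfSurjective hsurj), fun v w => ?_⟩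
  rw [secondFundamentalForm_apply hf]
  rfl

end Chart

end

/-! ### Comparison of the two embeddings -/

theorem mainTheorem5
    {M : Type*} [TopologicalSpace M] [ChartedSpace (EuclideanSpace ℝ (Fin 2)) M]
    [IsManifold (𝓡 2) ∞ M]
    (φ : FinslerMetric 2 M) (hφ : φ.IsMonochromatic) (p : M)
    {V₁ : Type*} [NormedAddCommGroup V₁] [NormedSpace ℝ V₁] [FiniteDimensional ℝ V₁]
    (hV₁ : Module.finrank ℝ V₁ = 3)
    {V₂ : Type*} [NormedAddCommGroup V₂] [NormedSpace ℝ V₂] [FiniteDimensional ℝ V₂]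
    (hV₂ : Module.finrank ℝ V₂ = 3)
    (Φ₁ : V₁ → ℝ) (hΦ₁ : IsBanachMinkowskiNorm Φ₁)
    (Φ₂ : V₂ → ℝ) (hΦ₂ : IsBanachMinkowskiNorm Φ₂)
    (f₁ : M → V₁) (hf₁ : φ.IsSmoothIsometricEmbedding Φ₁ f₁)
    (f₂ : M → V₂) (hf₂ : φ.IsSmoothIsometricEmbedding Φ₂ f₂) :
    (IsDefiniteForm (secondFundamentalForm 2 f₁ p) ∧
        IsDefiniteForm (secondFundamentalForm 2 f₂ p)) ∨
      (IsIndefiniteForm (secondFundamentalForm 2 f₁ p) ∧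
        IsIndefiniteForm (secondFundamentalForm 2 f₂ p)) ∨
      (IsDegenerateForm (secondFundamentalForm 2 f₁ p) ∧
        IsDegenerateForm (secondFundamentalForm 2 f₂ p)) := by
  have hG₁ := hf₁.isMonochromaticImmersion hΦ₁ hφ p
  have hG₂ := hf₂.isMonochromaticImmersion hΦ₂ hφ p
  have hu : extChartAt (𝓡 2) p p ∈ (extChartAt (𝓡 2) p).target := mem_extChartAt_target p
  obtain ⟨n₁, hI₁⟩ := exists_frame_isInvertible hV₁ (hG₁.injective _ hu)
  obtain ⟨n₂, hI₂⟩ := exists_frame_isInvertible hV₂ (hG₂.injective _ hu)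
  obtain ⟨ε₁, he₁⟩ := exists_secondFundamentalForm_eq hf₁.isSmoothEmbedding.contMDiff p hI₁
  obtain ⟨ε₂, he₂⟩ := exists_secondFundamentalForm_eq hf₂.isSmoothEmbedding.contMDiff p hI₂
  set G₁ := f₁ ∘ (extChartAt (𝓡 2) p).symm with hG₁'
  set G₂ := f₂ ∘ (extChartAt (𝓡 2) p).symm with hG₂'
  set u := extChartAt (𝓡 2) p p with hu'
  set b₁ := normalForm (fderiv ℝ G₁ u) n₁ (fderiv ℝ (fderiv ℝ G₁) u) with hb₁
  set b₂ := normalForm (fderiv ℝ G₂ u) n₂ (fderiv ℝ (fderiv ℝ G₂) u) with hb₂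
  have hs₁ : b₁ Plane.e₁ Plane.e₀ = b₁ Plane.e₀ Plane.e₁ :=
    congrArg (normalPart _ n₁) (hG₁.fderiv_fderiv_comm hu _ _)
  have hs₂ : b₂ Plane.e₁ Plane.e₀ = b₂ Plane.e₀ Plane.e₁ :=
    congrArg (normalPart _ n₂) (hG₂.fderiv_fderiv_comm hu _ _)
  have hGG : ∀ u ∈ (extChartAt (𝓡 2) p).target, ∀ v,
      Φ₁ (fderiv ℝ G₁ u v) ^ 2 = Φ₂ (fderiv ℝ G₂ u v) ^ 2 := fun u hu v => by
    rw [hf₁.norm_fderiv p hu, hf₂.norm_fderiv p hu]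
  -- Nondegeneracy of either form makes the common metric quadratic, and then the theorema egregium
  -- applies to both embeddings.
  have key : (formDet b₁ ≠ 0 ∨ formDet b₂ ≠ 0) →
      ∃ γ γ' : ℝ, 0 < γ ∧ 0 < γ' ∧ γ * formDet b₁ = γ' * formDet b₂ := by
    intro h
    refine hG₁.formDet_eq hΦ₁.isSquaredGauge hΦ₁.strictly_convex hG₂ hΦ₂.isSquaredGauge
      hΦ₂.strictly_convex hGG hu ?_ hI₁ hI₂
    rcases h with h | h
    · exact hG₁.isQuad_of_nondegenerate hΦ₁.isSquaredGauge hΦ₁.strictly_convex hu hI₁ h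
    · simp only [hGG u hu]
      exact hG₂.isQuad_of_nondegenerate hΦ₂.isSquaredGauge hΦ₂.strictly_convex hu hI₂ h
  rcases lt_trichotomy (formDet b₁) 0 with h | h | h
  · obtain ⟨γ, γ', hγ, hγ', heq⟩ := key (Or.inl h.ne)
    have h2 : formDet b₂ < 0 := by
      have := mul_neg_of_pos_of_neg hγ h
      rw [heq] at this
      exact neg_of_mul_neg_right this hγ'.le
    exact Or.inr (Or.inl ⟨isIndefiniteForm_of_formDet_neg he₁ hs₁ h,
      isIndefiniteForm_of_formDet_neg he₂ hs₂ h2⟩)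
  · have h2 : formDet b₂ = 0 := by
      by_contra h2
      obtain ⟨γ, γ', hγ, hγ', heq⟩ := key (Or.inr h2)
      rw [h, mul_zero] at heq
      exact mul_ne_zero hγ'.ne' h2 heq.symm
    exact Or.inr (Or.inr ⟨isDegenerateForm_of_formDet_eq_zero he₁ hs₁ h,
      isDegenerateForm_of_formDet_eq_zero he₂ hs₂ h2⟩)
  · obtain ⟨γ, γ', hγ, hγ', heq⟩ := key (Or.inl h.ne')
    have h2 : 0 < formDet b₂ := by
      have := mul_pos hγ h
      rw [heq] at this
      exact pos_of_mul_pos_right this hγ'.le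
    exact Or.inl ⟨isDefiniteForm_of_formDet_pos he₁ hs₁ h,
      isDefiniteForm_of_formDet_pos he₂ hs₂ h2⟩
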